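/- Let $n\ge 0$ and let $\Pi_n$ be the set of partitions of $[n]=\{1,\dots,n\}$. For $P\in\Pi_n$ let $\min(P)$ (resp. $\max(P)$) be the set of minimal (resp. maximal) elements of the blocks of $P$. The standard representation of $P$ is the set of arcs $(i,j)$ with $i<j$ such that $i,j$ lie in the same block of $P$ and no element of that block lies strictly between $i$ and $j$. The enhanced representation of $P$ is the union of the standard representation and the set of loops $(i,i)$ for the isolated points $i$ of $P$, i.e. those with $\{i\}$ a block of $P$. An enhanced $k$-crossing of $P$ is a set of $k$ edges $(i_1,j_1),\dots,(i_k,j_k)$ of the enhanced representation with $i_1<i_2<\cdots<i_k\le j_1<j_2<\cdots<j_k$; an enhanced $k$-nesting of $P$ is a set of $k$ such edges with $i_1<i_2<\cdots<i_k\le j_k<\cdots<j_2<j_1$. Let $\overline{\mathrm{cr}}(P)$ and $\overline{\mathrm{ne}}(P)$ be the sizes of the largest enhanced crossing and the largest enhanced nesting of $P$ (both $0$ if $n=0$). Theorem. Let $S,T\subseteq[n]$ be disjoint with $|S|=|T|$, and put $$\bar f_{n,S,T}(i,j)=\#\{P\in\Pi_n:\ \min(P)\setminus\max(P)=S,\ \max(P)\setminus\min(P)=T,\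 \overline{\mathrm{cr}}(P)=i,\ \overline{\mathrm{ne}}(P)=j\}.$$ Then $\bar f_{n,S,T}(i,j)=\bar f_{n,S,T}(j,i)$ for all integers $i,j\ge 0$. -/

import Mathlib

namespace EnhancedPartition

/-- The set `[n] = {1, …, n}`. -/
abbrev interval (n : ℕ) : Finset ℕ := Finset.Icc 1 n

/-- The set `Π_n` of partitions of `[n]`. -/
abbrev SetPartition (n : ℕ) : Type := Finpartition (interval n)

open Classical in
/-- `min(P)`: the minimal block elements of `P`. -/
noncomputable def minElts {n : ℕ} (P : SetPartition n) : Finset ℕ :=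
  (interval n).filter fun x => ∃ B ∈ P.parts, IsLeast (B : Set ℕ) x

open Classical in
/-- `max(P)`: the maximal block elements of `P`. -/
noncomputable def maxElts {n : ℕ} (P : SetPartition n) : Finset ℕ :=
  (interval n).filter fun x => ∃ B ∈ P.parts, IsGreatest (B : Set ℕ) x

open Classical in
/-- The standard representation of `P`: the arcs `(i, j)`, `i < j`, that join two elements of a
block of `P` which are consecutive in the numerical order of that block. -/
noncomputable def standardRep {n : ℕ} (P : SetPartition n) : Finset (ℕ × ℕ) :=
  (interval n ×ˢ interval n).filter fun e =>
    ∃ B ∈ P.parts, e.1 ∈ B ∧ e.2 ∈ B ∧ e.1 < e.2 ∧ ∀ m ∈ B, ¬ (e.1 < m ∧ m < e.2)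

open Classical in
/-- The loops `(i, i)` at the isolated points `i` of `P`, that is, at its singleton blocks. -/
noncomputable def loops {n : ℕ} (P : SetPartition n) : Finset (ℕ × ℕ) :=
  ((interval n).filter fun i => ({i} : Finset ℕ) ∈ P.parts).image fun i => (i, i)

/-- The enhanced representation of `P`. -/
noncomputable def enhancedRep {n : ℕ} (P : SetPartition n) : Finset (ℕ × ℕ) :=
  standardRep P ∪ loops P

/-- `A` consists of `k` edges `(i_1, j_1), …, (i_k, j_k)` with
`i_1 < ⋯ < i_k ≤ j_1 < ⋯ < j_k`. Since `i` and `j` are increasing, `i_k ≤ j_1` says that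
`i_a ≤ j_b` for all `a`, `b`. -/
def IsCrossing (k : ℕ) (A : Finset (ℕ × ℕ)) : Prop :=
  ∃ i j : Fin k → ℕ, StrictMono i ∧ StrictMono j ∧ (∀ a b, i a ≤ j b) ∧
    A = Finset.univ.image fun a => (i a, j a)

/-- `A` consists of `k` edges `(i_1, j_1), …, (i_k, j_k)` with
`i_1 < ⋯ < i_k ≤ j_k < ⋯ < j_1`. Since `i` is increasing and `j` is decreasing, `i_k ≤ j_k` says
that `i_a ≤ j_b` for all `a`, `b`. -/
def IsNesting (k : ℕ) (A : Finset (ℕ × ℕ)) : Prop :=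
  ∃ i j : Fin k → ℕ, StrictMono i ∧ StrictAnti j ∧ (∀ a b, i a ≤ j b) ∧
    A = Finset.univ.image fun a => (i a, j a)

open Classical in
/-- The size of the largest enhanced crossing of `P`. -/
noncomputable def enhancedCr {n : ℕ} (P : SetPartition n) : ℕ :=
  ((enhancedRep P).powerset.filter fun A => IsCrossing A.card A).sup Finset.card

open Classical in
/-- The size of the largest enhanced nesting of `P`. -/
noncomputable def enhancedNe {n : ℕ} (P : SetPartition n) : ℕ :=
  ((enhancedRep P).powerset.filter fun A => IsNesting A.card A).sup Finset.card

open Classical in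
/-- The set of partitions `P` of `[n]` with `min(P) \ max(P) = S` and `max(P) \ min(P) = T`. -/
noncomputable def partitionsWith (n : ℕ) (S T : Finset ℕ) : Finset (SetPartition n) :=
  Finset.univ.filter fun P => minElts P \ maxElts P = S ∧ maxElts P \ minElts P = T

/-- The number of partitions in `partitionsWith n S T` with enhanced crossing number `i` and
enhanced nesting number `j`. -/
noncomputable def jointCount (n : ℕ) (S T : Finset ℕ) (i j : ℕ) : ℕ :=
  ((partitionsWith n S T).filter fun P => enhancedCr P = i ∧ enhancedNe P = j).card

end EnhancedPartition

namespace EnhancedPartition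

/-! ### Growth diagrams in terms of edge labels -/

/-! The edge `(i, j)` of the enhanced representation becomes a point in the cell `(i - 1, n - j)` of
the staircase `x + y < n`; loops occupy the outermost diagonal `x + y = n - 1`. There is at most one
point in each row and column. A column is empty exactly when its element lies in `T`, a row exactly
when its element lies in `S`. A `k`-crossing is a chain of `k` points running to the lower right, a
`k`-nesting a chain running to the upper right, in both cases inside a rectangle contained in the
staircase.

Fomin's growth diagram attaches a partition to every lattice point of the staircase. Here it is
encoded by edge labels: a label is the number of the row that gains a box along that edge, counted
from `1`, and `0` means that nothing changes. The shape at `(x, Y)` thus has `cnt (c x) Y m` boxes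
in its `m`-th row. By Greene's theorem for single chains, the first row and the number of rows of a
shape are the lengths of the longest increasing and decreasing chains in the rectangle to its lower
left (`IsGrowth.hasInc_iff`, `IsGrowth.hasDec_iff`).

The local rules are reversible, so the points are determined by the shapes along the border of the
staircase (`IsGrowth.determined`), and every border sequence in which each step adds or removes at
most one box occurs (`exists_isGrowth`). Conjugating all border shapes is therefore an injective
operation on arrangements. It exchanges increasing with decreasing chains, and it keeps trivial
steps trivial, so the nonempty rows and columns, and with them `S` and `T`, are preserved
(`IsRook.exists_transpose`). As `S` and `T` are disjoint, the new arrangement is again the enhanced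
representation of a partition (`IsArcSet.exists_partition`). This injection gives one inequality,
and swapping `i` and `j` gives the other. -/

open Classical in
/-- The local rule: the label `a` of an edge after crossing an edge labelled `b` in a cell which
carries a point iff `p` holds. -/
noncomputable def bump (a b : ℕ) (p : Prop) : ℕ :=
  if a = b then (if a = 0 ∧ ¬ p then 0 else a + 1) else a

/-- The number of letters `m` among the first `Y` letters of the word `c`. -/
def cnt (c : ℕ → ℕ) (Y m : ℕ) : ℕ := ((Finset.range Y).filter fun y => c y = m).card

/-- The indicator function of the row `u - 1`, or zero if `u = 0`. -/
def unitRow (u m : ℕ) : ℕ := if u = m then 1 else 0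

/-- One column of a growth diagram: `c` and `c'` are the labels to its left and right, `r` the
labels on its horizontal edges, and `A` its set of points. -/
structure IsColumn (N : ℕ) (A : ℕ → Prop) (c c' r : ℕ → ℕ) : Prop where
  zero : r 0 = 0
  up : ∀ y < N, r (y + 1) = bump (r y) (c y) (A y)
  right : ∀ y < N, c' y = bump (c y) (r y) (A y)
  point : ∀ y < N, A y → r y = 0 ∧ c y = 0

/-- The Yamanouchi condition on the first `N` letters of a word; the letter `0` is ignored. -/
def IsYam (N : ℕ) (c : ℕ → ℕ) : Prop :=
  ∀ Y ≤ N, ∀ m, 1 ≤ m → cnt c Y (m + 1) ≤ cnt c Y m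

theorem bump_of_ne {a b : ℕ} (h : a ≠ b) (p : Prop) : bump a b p = a := by simp [bump, h]

theorem bump_self {a : ℕ} (h : a ≠ 0) (p : Prop) : bump a a p = a + 1 := by simp [bump, h]

theorem bump_zero {p : Prop} (h : p) : bump 0 0 p = 1 := by simp [bump, h]

theorem bump_zero_not {p : Prop} (h : ¬ p) (b : ℕ) : bump 0 b p = 0 := by simp [bump, h]

theorem le_bump (a b : ℕ) (p : Prop) : a ≤ bump a b p := by unfold bump; split_ifs <;> omega

theorem bump_le (a b : ℕ) (p : Prop) : bump a b p ≤ a + 1 := by unfold bump; split_ifs <;> omega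

theorem cnt_zero (c : ℕ → ℕ) (m : ℕ) : cnt c 0 m = 0 := by simp [cnt]

theorem cnt_succ (c : ℕ → ℕ) (Y m : ℕ) : cnt c (Y + 1) m = cnt c Y m + unitRow (c Y) m := by
  unfold cnt unitRow
  rw [Finset.range_add_one, Finset.filter_insert]
  split_ifs
  · rw [Finset.card_insert_of_notMem (by simp)]
  · simp

theorem cnt_mono (c : ℕ → ℕ) (m : ℕ) : Monotone fun Y => cnt c Y m :=
  monotone_nat_of_le_succ fun Y => by rw [cnt_succ]; omega

theorem cnt_congr {c d : ℕ → ℕ} {Y : ℕ} (h : ∀ y < Y, c y = d y) (m : ℕ) :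
    cnt c Y m = cnt d Y m := by
  unfold cnt
  congr 1
  exact Finset.filter_congr fun y hy => by rw [h y (Finset.mem_range.1 hy)]

theorem cnt_pos {c : ℕ → ℕ} {Y m : ℕ} : 0 < cnt c Y m ↔ ∃ y < Y, c y = m := by
  simp [cnt, Finset.card_pos, Finset.Nonempty]

theorem IsYam.congr {N : ℕ} {c d : ℕ → ℕ} (h : ∀ y < N, c y = d y) (hc : IsYam N c) :
    IsYam N d := fun Y hY m hm => by
  rw [← cnt_congr (fun y hy => h y (by omega)), ← cnt_congr (fun y hy => h y (by omega))]
  exact hc Y hY m hm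

theorem IsYam.mono {N M : ℕ} {c : ℕ → ℕ} (hc : IsYam N c) (h : M ≤ N) : IsYam M c :=
  fun Y hY => hc Y (hY.trans h)

theorem IsYam.cnt_anti {N : ℕ} {c : ℕ → ℕ} (hc : IsYam N c) {a b : ℕ} (ha : 1 ≤ a) (hab : a ≤ b) :
    cnt c N b ≤ cnt c N a := by
  induction b, hab using Nat.le_induction with
  | base => exact le_rfl
  | succ b hb ih => exact (hc N le_rfl b (by omega)).trans ih

/-! ### A single column: insertion and its inverse. -/

namespace IsColumn

variable {N : ℕ} {A : ℕ → Prop} {c c' r : ℕ → ℕ}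

theorem of_le (h : IsColumn N A c c' r) {M : ℕ} (hM : M ≤ N) : IsColumn M A c c' r :=
  ⟨h.zero, fun y hy => h.up y (by omega), fun y hy => h.right y (by omega),
    fun y hy => h.point y (by omega)⟩

/-- The shapes are independent of the lattice path: in each cell the two incoming labels either both
survive or are equal and are both replaced by the same value. -/
theorem cnt_eq (h : IsColumn N A c c' r) {m : ℕ} (hm : 1 ≤ m) :
    cnt c' N m = cnt c N m + unitRow (r N) m := by
  induction N with
  | zero => simp [cnt_zero, h.zero, unitRow]; omega
  | succ N ih =>
    rw [cnt_succ, cnt_succ, ih (h.of_le (by omega)), h.up N (by omega), h.right N (by omega)]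
    by_cases e : r N = c N
    · rw [e]
    · rw [bump_of_ne e, bump_of_ne (Ne.symm e)]; omega

theorem mono (h : IsColumn N A c c' r) {y z : ℕ} (hyz : y ≤ z) (hz : z ≤ N) : r y ≤ r z := by
  induction z, hyz using Nat.le_induction with
  | base => exact le_rfl
  | succ z hy ih =>
    refine (ih (by omega)).trans ?_
    rw [h.up z (by omega)]
    exact le_bump _ _ _

theorem point_lt (h : IsColumn N A c c' r) {y z : ℕ} (hy : y < N) (hA : A y) (hyz : y < z)
    (hz : z ≤ N) : 1 ≤ r z := by
  have h1 := h.up y hy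
  rw [(h.point y hy hA).1, (h.point y hy hA).2, bump_zero hA] at h1
  have := h.mono (show y + 1 ≤ z from hyz) hz
  omega

theorem top_ne_zero_iff (h : IsColumn N A c c' r) : r N ≠ 0 ↔ ∃ y < N, A y := by
  refine ⟨fun hr => ?_, fun ⟨y, hy, hA⟩ => by have := h.point_lt hy hA hy le_rfl; omega⟩
  by_contra! hA
  refine hr ?_
  have : ∀ y ≤ N, r y = 0 := fun y => by
    induction y with
    | zero => exact fun _ => h.zero
    | succ y ih =>
      intro hy
      rw [h.up y (by omega), ih (by omega), bump_zero_not (hA y (by omega))]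
  exact this N le_rfl

theorem point_unique (h : IsColumn N A c c' r) {y z : ℕ} (hy : y < N) (hz : z < N) (hAy : A y)
    (hAz : A z) : y = z := by
  rcases lt_trichotomy y z with hlt | heq | hlt
  · have := h.point_lt hy hAy hlt hz.le
    have := (h.point z hz hAz).1
    omega
  · exact heq
  · have := h.point_lt hz hAz hlt hy.le
    have := (h.point y hy hAy).1
    omega

/-- A column preserves the Yamanouchi condition. -/
theorem isYam (h : IsColumn N A c c' r) (hc : IsYam N c) : IsYam N c' := by
  induction N with
  | zero =>
    intro Y hY m hm
    obtain rfl : Y = 0 := by omega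
    simp [cnt_zero]
  | succ N ih =>
    have h' := h.of_le (Nat.le_succ N)
    have key := ih h' (hc.mono (Nat.le_succ N))
    intro Y hY m hm
    rcases Nat.lt_or_ge N Y with hlt | hle
    · obtain rfl : Y = N + 1 := by omega
      have a1 := hc N (by omega) m hm
      have a2 := hc (N + 1) le_rfl m hm
      have a3 := key N le_rfl m hm
      rw [h'.cnt_eq hm, h'.cnt_eq (by omega)] at a3
      rw [cnt_succ, cnt_succ] at a2
      rw [h.cnt_eq hm, h.cnt_eq (by omega), cnt_succ, cnt_succ, h.up N (by omega)]
      -- Around the top cell, the shapes at the three corners other than the upper right are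
      -- partitions. Two different labels add two independent boxes; equal labels `m ≠ 0` add boxes
      -- in rows `m` and `m + 1`.
      by_cases e : r N = c N
      · rw [e] at a3 ⊢
        unfold bump unitRow at *
        split_ifs at * <;> omega
      · rw [bump_of_ne e]
        unfold unitRow at *
        split_ifs at * <;> omega
    · exact key Y hle m hm

/-- A column is determined by its right labels and its top label. -/
theorem determined {B : ℕ → Prop} {d s : ℕ → ℕ} (h : IsColumn N A c c' r)
    (h' : IsColumn N B d c' s) (hN : r N = s N) : ∀ y < N, c y = d y ∧ (A y ↔ B y) := by
  induction N with
  | zero => intro y hy; omega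
  | succ N ih =>
    -- The local rule is invertible: different outgoing labels are unchanged, equal labels above `1`
    -- were lowered by one on entry, and the pair `1, 1` comes exactly from a point.
    have key : r N = s N ∧ c N = d N ∧ (A N ↔ B N) := by
      have h1 := h.up N (by omega)
      have h2 := h.right N (by omega)
      have h3 := h'.up N (by omega)
      have h4 := h'.right N (by omega)
      have h5 := h.point N (by omega)
      have h6 := h'.point N (by omega)
      unfold bump at h1 h2 h3 h4
      by_cases hA : A N <;> by_cases hB : B N <;>
        simp only [hA, hB, true_implies, not_true, not_false_eq_true, and_true, and_false,
          if_false] at * <;> split_ifs at * <;> omega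
    intro y hy
    rcases Nat.lt_or_ge y N with hlt | hle
    · exact ih (h.of_le (by omega)) (h'.of_le (by omega)) key.1 y hlt
    · obtain rfl : y = N := by omega
      exact key.2

end IsColumn

/-- Reverse insertion: a column exists with given right labels and given top label. -/
theorem exists_isColumn {N : ℕ} {c' : ℕ → ℕ} (hc' : IsYam N c') {u : ℕ}
    (hu : u ≠ 0 → cnt c' N (u + 1) < cnt c' N u) :
    ∃ (A : ℕ → Prop) (c r : ℕ → ℕ), IsColumn N A c c' r ∧ r N = u ∧ IsYam N c := by
  induction N generalizing u with
  | zero =>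
    have : u = 0 := by by_contra h; simpa [cnt_zero] using hu h
    refine ⟨fun _ => False, fun _ => 0, fun _ => 0, ⟨rfl, by simp, by simp, by simp⟩, this.symm, ?_⟩
    intro Y hY m hm
    obtain rfl : Y = 0 := by omega
    simp [cnt_zero]
  | succ N ih =>
    -- The inverse local rule in the top cell, together with the fact that row `u₀` of the next
    -- shape below has a removable box.
    obtain ⟨u₀, b, p, h1, h2, h3, h4⟩ : ∃ (u₀ b : ℕ) (p : Prop),
        (u₀ ≠ 0 → cnt c' N (u₀ + 1) < cnt c' N u₀) ∧ u = bump u₀ b p ∧ c' N = bump b u₀ p ∧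
          (p → u₀ = 0 ∧ b = 0) := by
      by_cases e : u = c' N
      · rcases Nat.lt_or_ge 1 u with hlt | hle
        · obtain ⟨v, rfl⟩ : ∃ v, u = v + 1 := ⟨u - 1, by omega⟩
          refine ⟨v, v, False, fun _ => ?_, ?_, ?_, by simp⟩
          · have := hc' (N + 1) le_rfl v (by omega)
            rw [cnt_succ, cnt_succ, ← e] at this
            unfold unitRow at this
            simp at this
            omega
          · rw [bump_self (by omega)]
          · rw [bump_self (by omega), e]
        · interval_cases u
          · exact ⟨0, 0, False, by simp, by simp [bump], by simp [bump, e], by simp⟩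
          · exact ⟨0, 0, True, by simp, by simp [bump], by simp [bump, e], by simp⟩
      · refine ⟨u, c' N, False, fun h0 => ?_, (bump_of_ne e _).symm,
          (bump_of_ne (Ne.symm e) _).symm, by simp⟩
        have := hu h0
        rw [cnt_succ, cnt_succ] at this
        unfold unitRow at this
        split_ifs at this <;> omega
    obtain ⟨A, c, r, hcol, hr, hyam⟩ := ih (hc'.mono (Nat.le_succ N)) h1
    have hcol' : IsColumn (N + 1) (fun y => if y = N then p else A y)
        (fun y => if y = N then b else c y) c' (fun y => if y = N + 1 then u else r y) := by
      constructor
      · simp [hcol.zero]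
      · intro y hy
        by_cases hyN : y = N
        · subst hyN; simp [h2, hr]
        · simp [hyN, show y ≠ N + 1 by omega, hcol.up y (by omega)]
      · intro y hy
        by_cases hyN : y = N
        · subst hyN; simp [h3, hr]
        · simp [hyN, show y ≠ N + 1 by omega, hcol.right y (by omega)]
      · intro y hy
        by_cases hyN : y = N
        · subst hyN; simpa [hr] using h4
        · simpa [hyN, show y ≠ N + 1 by omega] using hcol.point y (by omega)
    refine ⟨_, _, _, hcol', by simp, ?_⟩
    intro Y hY m hm
    -- At full height the left shape is the right one with a box removed from row `u`, which `hu`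
    -- permits; lower prefixes are covered by induction.
    rcases Nat.lt_or_ge N Y with hlt | hle
    · obtain rfl : Y = N + 1 := by omega
      have a1 := hc' (N + 1) le_rfl m hm
      have a2 := hcol'.cnt_eq hm
      have a3 := hcol'.cnt_eq (show 1 ≤ m + 1 by omega)
      simp only [if_true] at a2 a3
      unfold unitRow at a2 a3
      by_cases hum : u = m
      · subst hum
        have := hu (by omega)
        simp at a2 a3
        omega
      · simp only [hum, if_false] at a2
        omega
    · exact (hyam.congr fun y hy => by simp [show y ≠ N by omega]) Y hle m hm

/-! ### Growth diagrams on the staircase. -/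

/-- A partial permutation matrix in the staircase `x + y < n`. -/
structure IsRook (n : ℕ) (A : ℕ → ℕ → Prop) : Prop where
  board : ∀ {x y}, A x y → x + y < n
  col : ∀ {x y z}, A x y → A x z → y = z
  row : ∀ {x z y}, A x y → A z y → x = z

/-- The labels `r` and `c` of the horizontal and vertical edges of the growth diagram of `A`. -/
structure IsGrowth (n : ℕ) (A : ℕ → ℕ → Prop) (r c : ℕ → ℕ → ℕ) : Prop where
  zero : ∀ y, c 0 y = 0
  col : ∀ x < n, IsColumn (n - x) (A x) (c x) (c (x + 1)) (r x)

/-- The horizontal labels of a column with points `A` and left labels `c`. -/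
noncomputable def colLab (A : ℕ → Prop) (c : ℕ → ℕ) : ℕ → ℕ
  | 0 => 0
  | y + 1 => bump (colLab A c y) (c y) (A y)

/-- The vertical labels of the growth diagram of `A`. -/
noncomputable def rowLab (A : ℕ → ℕ → Prop) : ℕ → ℕ → ℕ
  | 0 => fun _ => 0
  | x + 1 => fun y => bump (rowLab A x y) (colLab (A x) (rowLab A x) y) (A x y)

theorem rowLab_eq_zero {A : ℕ → ℕ → Prop} {x y : ℕ} (h : ∀ z < x, ¬ A z y) : rowLab A x y = 0 := by
  induction x with
  | zero => rfl
  | succ x ih =>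
    change bump (rowLab A x y) _ _ = 0
    rw [ih fun z hz => h z (by omega)]
    exact bump_zero_not (h x (by omega)) _

theorem colLab_eq_zero {A : ℕ → Prop} {c : ℕ → ℕ} {y : ℕ} (h : ∀ z < y, ¬ A z) :
    colLab A c y = 0 := by
  induction y with
  | zero => rfl
  | succ y ih =>
    rw [colLab, ih fun z hz => h z (by omega)]
    exact bump_zero_not (h y (by omega)) _

theorem IsRook.isGrowth {n : ℕ} {A : ℕ → ℕ → Prop} (h : IsRook n A) :
    IsGrowth n A (fun x => colLab (A x) (rowLab A x)) (rowLab A) :=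
  ⟨fun _ => rfl, fun x _ => ⟨rfl, fun _ _ => rfl, fun _ _ => rfl, fun _ _ hA =>
    ⟨colLab_eq_zero fun _ hz hA' => by have := h.col hA hA'; omega,
      rowLab_eq_zero fun _ hz hA' => by have := h.row hA hA'; omega⟩⟩⟩

/-! ### Layers (Viennot's shadow construction) and monotone chains. -/

/-- The cells both of whose outgoing labels are `m`. -/
def layer (n : ℕ) (r c : ℕ → ℕ → ℕ) (m x y : ℕ) : Prop :=
  x + y < n ∧ r x (y + 1) = m ∧ c (x + 1) y = m

/-- There is a sequence of `k` points of `Q` in the rectangle `X × Y` running to the lower right. -/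
def HasDec (Q : ℕ → ℕ → Prop) (k X Y : ℕ) : Prop :=
  ∃ f g : ℕ → ℕ, (∀ a < k, Q (f a) (g a) ∧ f a < X ∧ g a < Y) ∧
    ∀ a b, a < b → b < k → f a < f b ∧ g b < g a

/-- There is a sequence of `k` points of `Q` in the rectangle `X × Y` running to the upper right. -/
def HasInc (Q : ℕ → ℕ → Prop) (k X Y : ℕ) : Prop :=
  ∃ f g : ℕ → ℕ, (∀ a < k, Q (f a) (g a) ∧ f a < X ∧ g a < Y) ∧
    ∀ a b, a < b → b < k → f a < f b ∧ g a < g b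

theorem dec_of_consecutive {k : ℕ} {f g : ℕ → ℕ}
    (h : ∀ a, a + 1 < k → f a < f (a + 1) ∧ g (a + 1) < g a) :
    ∀ a b, a < b → b < k → f a < f b ∧ g b < g a := by
  intro a b hab
  induction b, hab using Nat.le_induction with
  | base => exact h a
  | succ b hb ih =>
    intro hk
    have h1 := h b hk
    have h2 := ih (by omega)
    omega

namespace IsGrowth

variable {n : ℕ} {A : ℕ → ℕ → Prop} {r c : ℕ → ℕ → ℕ}

theorem up (h : IsGrowth n A r c) {x y : ℕ} (hxy : x + y < n) :
    r x (y + 1) = bump (r x y) (c x y) (A x y) :=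
  (h.col x (by omega)).up y (by omega)

theorem right (h : IsGrowth n A r c) {x y : ℕ} (hxy : x + y < n) :
    c (x + 1) y = bump (c x y) (r x y) (A x y) :=
  (h.col x (by omega)).right y (by omega)

theorem point (h : IsGrowth n A r c) {x y : ℕ} (hxy : x + y < n) (hA : A x y) :
    r x y = 0 ∧ c x y = 0 :=
  (h.col x (by omega)).point y (by omega) hA

/-- A label `m` moves along its row or column until it meets another `m`; the next layer consists of
these collisions, and the first layer (`layer_one`) of the points themselves. -/
theorem layer_succ (h : IsGrowth n A r c) {m x y : ℕ} (hm : 1 ≤ m) :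
    layer n r c (m + 1) x y ↔ x + y < n ∧ r x y = m ∧ c x y = m := by
  refine and_congr_right fun hxy => ?_
  rw [h.up hxy, h.right hxy]
  generalize r x y = a
  generalize c x y = b
  by_cases e : a = b
  · subst e
    rcases Nat.eq_zero_or_pos a with rfl | ha
    · have := bump_le 0 0 (A x y)
      omega
    · rw [bump_self ha.ne']
      omega
  · rw [bump_of_ne e, bump_of_ne (Ne.symm e)]
    omega

theorem layer_one (h : IsGrowth n A r c) {x y : ℕ} :
    layer n r c 1 x y ↔ x + y < n ∧ A x y := by
  refine and_congr_right fun hxy => ?_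
  have := h.point hxy
  rw [h.up hxy, h.right hxy]
  by_cases hA : A x y
  · simp [hA, this hA, bump]
  · generalize r x y = a
    generalize c x y = b
    simp only [hA, iff_false]
    by_cases e : a = b
    · subst e
      rcases Nat.eq_zero_or_pos a with rfl | ha
      · simp [bump]
      · rw [bump_self ha.ne']
        omega
    · rw [bump_of_ne e, bump_of_ne (Ne.symm e)]
      omega

theorem layer_of_right_ne (h : IsGrowth n A r c) {x y : ℕ} (hxy : x + y < n)
    (hne : c (x + 1) y ≠ c x y) : layer n r c (c x y + 1) x y := by
  refine ⟨hxy, ?_⟩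
  rw [h.right hxy] at hne ⊢
  rw [h.up hxy]
  by_cases e : c x y = r x y
  · rw [← e] at hne ⊢
    unfold bump at *
    split_ifs at * <;> simp_all
  · exact absurd (bump_of_ne e _) hne

theorem layer_of_up_ne (h : IsGrowth n A r c) {x y : ℕ} (hxy : x + y < n)
    (hne : r x (y + 1) ≠ r x y) : layer n r c (r x y + 1) x y := by
  refine ⟨hxy, ?_⟩
  rw [h.up hxy] at hne ⊢
  rw [h.right hxy]
  by_cases e : r x y = c x y
  · rw [← e] at hne ⊢
    unfold bump at *
    split_ifs at * <;> simp_all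
  · exact absurd (bump_of_ne e _) hne

theorem right_mono (h : IsGrowth n A r c) {x z y : ℕ} (hxz : x ≤ z) (hz : z + y ≤ n) :
    c x y ≤ c z y := by
  induction z, hxz using Nat.le_induction with
  | base => exact le_rfl
  | succ z hx ih =>
    refine (ih (by omega)).trans ?_
    rw [h.right (by omega)]
    exact le_bump _ _ _

theorem up_mono (h : IsGrowth n A r c) {x y z : ℕ} (hyz : y ≤ z) (hx : x < n) (hz : x + z ≤ n) :
    r x y ≤ r x z := (h.col x hx).mono hyz (by omega)

/-- A discrete intermediate value argument: labels rise by at most one per cell, and only in a cell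
of the corresponding layer. -/
theorem exists_layer_right (h : IsGrowth n A r c) {m x z y : ℕ} (hxz : x ≤ z) (hz : z + y ≤ n)
    (h1 : c x y < m) (h2 : m ≤ c z y) : ∃ x', x ≤ x' ∧ x' < z ∧ layer n r c m x' y := by
  induction z, hxz using Nat.le_induction with
  | base => omega
  | succ z hx ih =>
    by_cases hlt : m ≤ c z y
    · obtain ⟨x', a, b, d⟩ := ih (by omega) hlt
      exact ⟨x', a, by omega, d⟩
    · have key := h.layer_of_right_ne (x := z) (y := y) (by omega) (by omega)
      have := key.2.2
      rw [show c z y + 1 = m by omega] at key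
      exact ⟨z, hx, by omega, key⟩

theorem exists_layer_up (h : IsGrowth n A r c) {m x y z : ℕ} (hyz : y ≤ z) (hz : x + z ≤ n)
    (h1 : r x y < m) (h2 : m ≤ r x z) : ∃ y', y ≤ y' ∧ y' < z ∧ layer n r c m x y' := by
  induction z, hyz using Nat.le_induction with
  | base => omega
  | succ z hy ih =>
    by_cases hlt : m ≤ r x z
    · obtain ⟨x', a, b, d⟩ := ih (by omega) hlt
      exact ⟨x', a, by omega, d⟩
    · have key := h.layer_of_up_ne (x := x) (y := z) (by omega) (by omega)
      have := key.2.1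
      rw [show r x z + 1 = m by omega] at key
      exact ⟨z, hy, by omega, key⟩

/-- Equal labels entering a box from the left and from below collide in it. -/
theorem exists_collision (h : IsGrowth n A r c) {m x₀ x₁ y₀ y₁ : ℕ} (hm : 1 ≤ m) (hx : x₀ ≤ x₁)
    (hy : y₀ ≤ y₁) (hb : x₁ + y₁ < n) (hc : c x₀ y₁ = m) (hr : r x₁ y₀ = m) :
    ∃ x y, layer n r c (m + 1) x y ∧ x₀ ≤ x ∧ x ≤ x₁ ∧ y₀ ≤ y ∧ y ≤ y₁ := by
  by_contra! hno
  -- Without a collision, one label runs along the top row of the box and the other up its right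
  -- column, so both reach the corner `(x₁, y₁)` and collide there.
  have e1 : c x₁ y₁ = m := by
    by_contra hne
    have := h.right_mono (y := y₁) hx (by omega)
    obtain ⟨x', a, b, d⟩ := h.exists_layer_right (m := m + 1) (y := y₁) hx (by omega) (by omega)
      (by omega)
    have := hno x' y₁ d a b.le hy
    omega
  have e2 : r x₁ y₁ = m := by
    by_contra hne
    have := h.up_mono (x := x₁) hy (by omega) (by omega)
    obtain ⟨y', a, b, d⟩ := h.exists_layer_up (m := m + 1) (x := x₁) hy (by omega) (by omega)
      (by omega)
    have := hno x₁ y' d hx le_rfl a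
    omega
  have := hno x₁ y₁ ((h.layer_succ hm).2 ⟨hb, e2, e1⟩) hx le_rfl hy
  omega

/-- Passing to the next layer shortens decreasing chains by one: its points interlace with those of
the previous layer. The bound on `X + Y` keeps the rectangle inside the staircase. -/
theorem hasDec_layer_succ (h : IsGrowth n A r c) {m k X Y : ℕ} (hm : 1 ≤ m) (hk : 1 ≤ k)
    (hXY : X + Y ≤ n + 1) :
    HasDec (layer n r c m) (k + 1) X Y ↔ HasDec (layer n r c (m + 1)) k X Y := by
  constructor
  · rintro ⟨f, g, h1, h2⟩
    -- The label leaving point `a` to the right and the one leaving point `a + 1` upwards enter a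
    -- common box, where they collide.
    have key : ∀ a, ∃ x y, a < k → layer n r c (m + 1) x y ∧ f a + 1 ≤ x ∧ x ≤ f (a + 1) ∧
        g (a + 1) + 1 ≤ y ∧ y ≤ g a := by
      intro a
      by_cases ha : a < k
      · have p1 := h1 a (by omega)
        have p2 := h1 (a + 1) (by omega)
        have p3 := h2 a (a + 1) (by omega) (by omega)
        obtain ⟨x, y, hxy⟩ := h.exists_collision (x₀ := f a + 1) (x₁ := f (a + 1))
          (y₀ := g (a + 1) + 1) (y₁ := g a) hm (by omega) (by omega) (by omega) p1.1.2.2 p2.1.2.1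
        exact ⟨x, y, fun _ => hxy⟩
      · exact ⟨0, 0, fun hh => absurd hh ha⟩
    choose u v huv using key
    refine ⟨u, v, fun a ha => ?_, dec_of_consecutive fun a ha => ?_⟩
    · have p1 := h1 a (by omega)
      have p2 := h1 (a + 1) (by omega)
      have := huv a ha
      exact ⟨this.1, by omega, by omega⟩
    · have p1 := (huv a (by omega)).2
      have p2 := (huv (a + 1) (by omega)).2
      omega
  · rintro ⟨f, g, h1, h2⟩
    -- The `k + 1` interlacing points: one to the left of the first given point in its row, one
    -- below the last in its column, and one in the box between each consecutive pair.
    have key : ∀ a, ∃ x y, a < k + 1 → layer n r c m x y ∧ (a < k → x < f a ∧ g a ≤ y) ∧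
        (0 < a → f (a - 1) ≤ x ∧ y < g (a - 1)) ∧ x < X ∧ y < Y := by
      intro a
      rcases Nat.lt_or_ge k a with hka | hka
      · exact ⟨0, 0, fun hh => by omega⟩
      rcases Nat.eq_zero_or_pos a with rfl | ha
      · have p1 := h1 0 (by omega)
        have p2 := (h.layer_succ hm).1 p1.1
        obtain ⟨x', b1, b2, b3⟩ := h.exists_layer_right (m := m) (Nat.zero_le (f 0))
          (y := g 0) (by omega) (by have := h.zero (g 0); omega) (by omega)
        exact ⟨x', g 0, fun _ => ⟨b3, fun _ => ⟨b2, le_rfl⟩, by omega, by omega, by omega⟩⟩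
      · have p1 := h1 (a - 1) (by omega)
        have p2 := (h.layer_succ hm).1 p1.1
        have hr0 := (h.col (f (a - 1)) (by omega)).zero
        rcases Nat.lt_or_ge a k with hak | hak
        · have q1 := h1 a (by omega)
          have q2 := (h.layer_succ hm).1 q1.1
          have q3 := h2 (a - 1) a (by omega) (by omega)
          have hbox : ∃ x y, layer n r c m x y ∧ f (a - 1) ≤ x ∧ x < f a ∧ g a ≤ y ∧
              y < g (a - 1) := by
            by_contra! hno
            -- If the box has no point of layer `m`, both labels trace back to its lower left corner
            -- and collide there. The label going up from it is then `m + 1`, and by monotonicity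
            -- cannot be `m` again at the upper point.
            have e1 : r (f (a - 1)) (g a) = m := by
              by_contra hne
              have := h.up_mono (x := f (a - 1)) q3.2.le (by omega) (by omega)
              obtain ⟨y', b1, b2, b3⟩ := h.exists_layer_up (m := m) (x := f (a - 1)) q3.2.le
                (by omega) (by omega) (by omega)
              have := hno _ y' b3 le_rfl q3.1 b1
              omega
            have e2 : c (f (a - 1)) (g a) = m := by
              by_contra hne
              have := h.right_mono (y := g a) q3.1.le (by omega)
              obtain ⟨x', b1, b2, b3⟩ := h.exists_layer_right (m := m) (y := g a) q3.1.le
                (by omega) (by omega) (by omega)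
              have := hno x' _ b3 b1 b2 le_rfl
              omega
            have e3 := (h.layer_succ hm).2 ⟨by omega, e1, e2⟩
            have := h.up_mono (x := f (a - 1)) (y := g a + 1) q3.2 (by omega) (by omega)
            have := e3.2.1
            omega
          obtain ⟨x, y, b1, b2, b3, b4, b5⟩ := hbox
          exact ⟨x, y, fun _ => ⟨b1, fun _ => ⟨b3, b4⟩, fun _ => ⟨b2, b5⟩, by omega, by omega⟩⟩
        · obtain ⟨y', b1, b2, b3⟩ := h.exists_layer_up (m := m) (x := f (a - 1))
            (Nat.zero_le (g (a - 1))) (by omega) (by omega) (by omega)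
          exact ⟨f (a - 1), y', fun _ => ⟨b3, by omega, fun _ => ⟨le_rfl, b2⟩, by omega,
            by omega⟩⟩
    choose u v huv using key
    refine ⟨u, v, fun a ha => ?_, dec_of_consecutive fun a ha => ?_⟩
    · exact ⟨(huv a ha).1, (huv a ha).2.2.2⟩
    · have p1 := (huv a (by omega)).2.1 (by omega)
      have p2 := (huv (a + 1) ha).2.2.1 (by omega)
      simp only [Nat.add_sub_cancel] at p2
      omega

theorem hasDec_layer_iff (h : IsGrowth n A r c) {m k X Y : ℕ} (hm : 1 ≤ m) (hk : 1 ≤ k)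
    (hXY : X + Y ≤ n + 1) :
    HasDec (layer n r c m) k X Y ↔ ∃ x < X, ∃ y < Y, layer n r c (m + k - 1) x y := by
  induction k, hk using Nat.le_induction generalizing m with
  | base =>
    constructor
    · rintro ⟨f, g, h1, -⟩
      exact ⟨f 0, (h1 0 one_pos).2.1, g 0, (h1 0 one_pos).2.2, (h1 0 one_pos).1⟩
    · rintro ⟨x, hx, y, hy, hl⟩
      exact ⟨fun _ => x, fun _ => y, fun _ _ => ⟨hl, hx, hy⟩, by omega⟩
  | succ k hk ih =>
    rw [h.hasDec_layer_succ hm hk hXY, ih (by omega)]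
    rw [show m + 1 + k - 1 = m + (k + 1) - 1 by omega]

theorem isYam (h : IsGrowth n A r c) {x : ℕ} (hx : x ≤ n) : IsYam (n - x) (c x) := by
  induction x with
  | zero =>
    intro Y _ m hm
    have : cnt (c 0) Y (m + 1) = 0 := by
      by_contra hne
      obtain ⟨y, _, hy⟩ := cnt_pos.1 (Nat.pos_of_ne_zero hne)
      have := h.zero y
      omega
    omega
  | succ x ih => exact ((h.col x hx).isYam (ih (by omega))).mono (by omega)

theorem isYam_succ (h : IsGrowth n A r c) {x : ℕ} (hx : x < n) : IsYam (n - x) (c (x + 1)) :=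
  (h.col x hx).isYam (h.isYam hx.le)

/-- Decreasing sequences of points correspond to the number of rows of the shape. -/
theorem hasDec_iff (h : IsGrowth n A r c) (hA : ∀ x y, A x y → x + y < n) {k x : ℕ} (hk : 1 ≤ k)
    (hx : x < n) : HasDec A k (x + 1) (n - x) ↔ 0 < cnt (c (x + 1)) (n - x) k := by
  have e : A = layer n r c 1 := by
    ext x y
    rw [h.layer_one]
    exact ⟨fun hh => ⟨hA x y hh, hh⟩, fun hh => hh.2⟩
  rw [e, h.hasDec_layer_iff le_rfl hk (by omega), show 1 + k - 1 = k by omega]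
  constructor
  · rintro ⟨x', hx', y, hy, hl⟩
    -- A point of layer `k` forces a label at least `k` on the right side; the Yamanouchi condition
    -- then supplies `k` itself.
    have h1 := h.right_mono (x := x' + 1) (z := x + 1) (y := y) (by omega) (by omega)
    rw [hl.2.2] at h1
    have : 0 < cnt (c (x + 1)) (n - x) (c (x + 1) y) := cnt_pos.2 ⟨y, hy, rfl⟩
    exact this.trans_le ((h.isYam_succ hx).cnt_anti hk h1)
  · intro hpos
    obtain ⟨y, hy, hl⟩ := cnt_pos.1 hpos
    obtain ⟨x', a, b, d⟩ := h.exists_layer_right (Nat.zero_le (x + 1)) (y := y) (m := k) (by omega)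
      (by have := h.zero y; omega) hl.ge
    exact ⟨x', b, y, hy, d⟩

theorem cnt_succ_eq (h : IsGrowth n A r c) {x Y m : ℕ} (hb : x + Y ≤ n) (hx : x < n)
    (hm : 1 ≤ m) : cnt (c (x + 1)) Y m = cnt (c x) Y m + unitRow (r x Y) m :=
  ((h.col x hx).of_le (by omega)).cnt_eq hm

theorem cnt_mono_right (h : IsGrowth n A r c) {x z Y m : ℕ} (hxz : x ≤ z) (hb : z + Y ≤ n + 1)
    (hz : z ≤ n) (hm : 1 ≤ m) : cnt (c x) Y m ≤ cnt (c z) Y m := by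
  induction z, hxz using Nat.le_induction with
  | base => exact le_rfl
  | succ z hx ih =>
    rw [h.cnt_succ_eq (by omega) (by omega) hm]
    have := ih (by omega) (by omega)
    omega

/-- Shapes grow to the right and upwards, and each point of the chain contributes a new box to the
first row. -/
theorem le_cnt_of_inc (h : IsGrowth n A r c) {f g : ℕ → ℕ} {k : ℕ}
    (hf : ∀ a < k, A (f a) (g a) ∧ f a + g a < n)
    (hlt : ∀ a b, a < b → b < k → f a < f b ∧ g a < g b) {X Y : ℕ} (hX : X ≤ n)
    (hXY : X + Y ≤ n + 1) (hrect : ∀ a < k, f a < X ∧ g a < Y) : k ≤ cnt (c X) Y 1 := by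
  induction k generalizing X Y with
  | zero => omega
  | succ k ih =>
    have p := hf k (by omega)
    have q := hrect k (by omega)
    have h1 := ih (fun a ha => hf a (by omega)) (fun a b hab hb => hlt a b hab (by omega))
      (X := f k) (Y := g k) (by omega) (by omega) (fun a ha => hlt a k ha (by omega))
    -- The label below a point is `0`, so the shape is unchanged along the bottom of the cell; the
    -- label `1` on its right side adds the box.
    have h2 : cnt (c (f k + 1)) (g k + 1) 1 = cnt (c (f k)) (g k) 1 + 1 := by
      have hl := h.layer_one.2 ⟨p.2, p.1⟩
      have hp := h.point p.2 p.1
      rw [cnt_succ, hl.2.2, h.cnt_succ_eq (by omega) (by omega) le_rfl, hp.1]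
      rfl
    have h3 := h.cnt_mono_right (x := f k + 1) (z := X) (Y := g k + 1) (m := 1) (by omega) (by omega) hX le_rfl
    have h4 := cnt_mono (c X) 1 (show g k + 1 ≤ Y by omega)
    simp only at h4
    omega

/-- Backtracking from the upper right corner: one moves left or down while the first row stays long
enough. When neither is possible, the cell just passed carries a point, which ends the chain. -/
theorem exists_inc (h : IsGrowth n A r c) {X Y : ℕ} (hX : X ≤ n) (hXY : X + Y ≤ n + 1) {k : ℕ}
    (hk : k ≤ cnt (c X) Y 1) : HasInc A k X Y := by
  induction X generalizing Y k with
  | zero =>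
    have : cnt (c 0) Y 1 = 0 := by
      by_contra hne
      obtain ⟨y, _, hy⟩ := cnt_pos.1 (Nat.pos_of_ne_zero hne)
      have := h.zero y
      omega
    exact ⟨fun _ => 0, fun _ => 0, fun a ha => by omega, fun a b _ hb => by omega⟩
  | succ X ihX =>
    induction Y generalizing k with
    | zero =>
      rw [cnt_zero] at hk
      exact ⟨fun _ => 0, fun _ => 0, fun a ha => by omega, fun a b _ hb => by omega⟩
    | succ Y ihY =>
      by_cases h1 : k ≤ cnt (c X) (Y + 1) 1
      · obtain ⟨f, g, p, q⟩ := ihX (by omega) (by omega) h1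
        exact ⟨f, g, fun a ha => ⟨(p a ha).1, by have := (p a ha).2; omega⟩, q⟩
      by_cases h2 : k ≤ cnt (c (X + 1)) Y 1
      · obtain ⟨f, g, p, q⟩ := ihY (by omega) h2
        exact ⟨f, g, fun a ha => ⟨(p a ha).1, by have := (p a ha).2; omega⟩, q⟩
      have e1 := h.cnt_succ_eq (x := X) (Y := Y + 1) (m := 1) (by omega) (by omega) le_rfl
      have e2 := cnt_succ (c (X + 1)) Y 1
      have e3 := cnt_succ (c X) Y 1
      unfold unitRow at e1 e2 e3
      have hl : layer n r c 1 X Y := by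
        refine ⟨by omega, ?_, ?_⟩ <;> by_contra hne <;> simp only [hne, if_false] at e1 e2 <;> omega
      have hA := (h.layer_one.1 hl).2
      have hc := (h.point hl.1 hA).2
      have e5 : cnt (c X) Y 1 = k - 1 := by
        simp only [hc, hl.2.1, if_true, zero_ne_one, if_false] at e1 e3
        omega
      obtain ⟨f, g, p, q⟩ := ihX (Y := Y) (by omega) (by omega) e5.ge
      refine ⟨fun a => if a < k - 1 then f a else X, fun a => if a < k - 1 then g a else Y,
        fun a ha => ?_, fun a b hab hb => ?_⟩
      · by_cases hak : a < k - 1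
        · simp only [hak, if_true]
          exact ⟨(p a hak).1, by have := (p a hak).2; omega⟩
        · simp only [hak, if_false]
          exact ⟨hA, by omega⟩
      · have hak : a < k - 1 := by omega
        by_cases hbk : b < k - 1
        · simp only [hak, hbk, if_true]
          exact q a b hab hbk
        · simp only [hak, hbk, if_true, if_false]
          exact (p a hak).2

/-- Increasing sequences of points correspond to the length of the first row of the shape. -/
theorem hasInc_iff (h : IsGrowth n A r c) (hA : ∀ x y, A x y → x + y < n) {k x : ℕ} (hx : x < n) :
    HasInc A k (x + 1) (n - x) ↔ k ≤ cnt (c (x + 1)) (n - x) 1 := by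
  refine ⟨fun ⟨f, g, p, q⟩ => ?_, h.exists_inc hx (by omega)⟩
  exact h.le_cnt_of_inc (fun a ha => ⟨(p a ha).1, hA _ _ (p a ha).1⟩) q hx (by omega)
    fun a ha => (p a ha).2

theorem exists_row_iff (h : IsGrowth n A r c) (hA : ∀ x y, A x y → x + y < n) {y : ℕ} (hy : y < n) :
    (∃ x, A x y) ↔ c (n - y) y ≠ 0 := by
  constructor
  · rintro ⟨x, hxy⟩
    have hb := hA x y hxy
    have h1 := (h.layer_one.2 ⟨hb, hxy⟩).2.2
    have := h.right_mono (x := x + 1) (z := n - y) (y := y) (by omega) (by omega)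
    omega
  · intro hne
    obtain ⟨x, -, -, hl⟩ := h.exists_layer_right (Nat.zero_le (n - y)) (y := y) (m := 1) (by omega)
      (by have := h.zero y; omega) (by omega)
    exact ⟨x, (h.layer_one.1 hl).2⟩

theorem exists_col_iff (h : IsGrowth n A r c) (hA : ∀ x y, A x y → x + y < n) {x : ℕ} (hx : x < n) :
    (∃ y, A x y) ↔ r x (n - x) ≠ 0 := by
  rw [(h.col x hx).top_ne_zero_iff]
  exact ⟨fun ⟨y, hy⟩ => ⟨y, by have := hA x y hy; omega, hy⟩, fun ⟨y, _, hy⟩ => ⟨y, hy⟩⟩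

end IsGrowth

/-! ### Border shapes and transposition -/

theorem unitRow_injective {u v : ℕ} (h : ∀ m, unitRow u (m + 1) = unitRow v (m + 1)) : u = v := by
  by_contra hne
  have h1 := h (u - 1)
  have h2 := h (v - 1)
  unfold unitRow at h1 h2
  split_ifs at * <;> omega

theorem IsColumn.congr {N : ℕ} {A B : ℕ → Prop} {c c' d d' r : ℕ → ℕ} (h : IsColumn N A c c' r)
    (hA : ∀ y < N, A y ↔ B y) (hc : ∀ y < N, c y = d y) (hc' : ∀ y < N, c' y = d' y) :
    IsColumn N B d d' r where
  zero := h.zero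
  up y hy := by rw [h.up y hy, hc y hy, propext (hA y hy)]
  right y hy := by rw [← hc' y hy, h.right y hy, hc y hy, propext (hA y hy)]
  point y hy hB := by rw [← hc y hy]; exact h.point y hy ((hA y hy).2 hB)

theorem IsColumn.unique {N : ℕ} {A : ℕ → Prop} {c c' d d' r s : ℕ → ℕ} (h : IsColumn N A c c' r)
    (h' : IsColumn N A d d' s) (hc : ∀ y < N, c y = d y) : ∀ y < N, c' y = d' y := by
  have key : ∀ y ≤ N, r y = s y := fun y => by
    induction y with
    | zero => intro _; rw [h.zero, h'.zero]
    | succ y ih => intro hy; rw [h.up y hy, h'.up y hy, ih (by omega), hc y hy]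
  intro y hy
  rw [h.right y hy, h'.right y hy, key y hy.le, hc y hy]

namespace IsGrowth

variable {n : ℕ} {A B : ℕ → ℕ → Prop} {r c s d : ℕ → ℕ → ℕ}

/-- Identifies a diagram built from its border with the canonical labels `rowLab` of its points. -/
theorem unique (h : IsGrowth n A r c) (h' : IsGrowth n A s d) {x y : ℕ} (hxy : x + y ≤ n) :
    c x y = d x y := by
  induction x generalizing y with
  | zero => rw [h.zero, h'.zero]
  | succ x ih =>
    exact (h.col x (by omega)).unique (h'.col x (by omega)) (fun y hy => ih (by omega)) y (by omega)

/-- The points are determined by the shapes along the border of the staircase. -/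
theorem determined (h : IsGrowth n A r c) (h' : IsGrowth n B s d)
    (h1 : ∀ x < n, ∀ m, cnt (c x) (n - x) (m + 1) = cnt (d x) (n - x) (m + 1))
    (h2 : ∀ x < n, ∀ m, cnt (c (x + 1)) (n - x) (m + 1) = cnt (d (x + 1)) (n - x) (m + 1)) {x y : ℕ}
    (hxy : x + y < n) : A x y ↔ B x y := by
  have key : ∀ k x, x + k = n → ∀ y < k, c x y = d x y ∧ (A x y ↔ B x y) := by
    intro k
    induction k with
    | zero => intro x _ y hy; omega
    | succ k ih =>
      intro x hx
      -- Columns are treated from right to left. The column to the right yields all right labels but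
      -- the top one; that one and the top horizontal label are differences of successive border
      -- shapes.
      have h3 : ∀ m, cnt (c (x + 1)) k (m + 1) = cnt (d (x + 1)) k (m + 1) := fun m =>
        cnt_congr (fun y hy => (ih (x + 1) (by omega) y hy).1) _
      have e : n - x = k + 1 := by omega
      have h4 : c (x + 1) k = d (x + 1) k := unitRow_injective fun m => by
        have := h2 x (by omega) m
        rw [e, cnt_succ, cnt_succ, h3] at this
        omega
      have h5 : r x (n - x) = s x (n - x) := unitRow_injective fun m => by
        have a1 := h.cnt_succ_eq (x := x) (Y := n - x) (m := m + 1) (by omega) (by omega) (by omega)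
        have a2 := h'.cnt_succ_eq (x := x) (Y := n - x) (m := m + 1) (by omega) (by omega)
          (by omega)
        have a3 := h1 x (by omega) m
        have a4 := h2 x (by omega) m
        omega
      have h6 := (h.col x (by omega)).congr (fun _ _ => Iff.rfl) (fun _ _ => rfl) (d' := d (x + 1))
        fun y hy => by
          rcases Nat.lt_or_ge y k with hlt | hge
          · exact (ih (x + 1) (by omega) y hlt).1
          · obtain rfl : y = k := by omega
            exact h4
      intro y hy
      exact h6.determined (h'.col x (by omega)) h5 y (by omega)
  exact (key (n - x) x (by omega) y (by omega)).2

/-- A point needs incoming labels `0`, while beyond a point all labels in its row and column are at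
least `1`. -/
theorem isRook (h : IsGrowth n A r c) (hA : ∀ x y, A x y → x + y < n) : IsRook n A := by
  have key : ∀ {x z y}, x < z → A x y → A z y → False := by
    intro x z y hxz h1 h2
    have a1 := (h.layer_one.2 ⟨hA _ _ h1, h1⟩).2.2
    have a2 := (h.point (hA _ _ h2) h2).2
    have a3 := hA _ _ h2
    have := h.right_mono (x := x + 1) (z := z) (y := y) hxz (by omega)
    omega
  refine ⟨fun h1 => hA _ _ h1, fun {x y z} h1 h2 => ?_, fun {x z y} h1 h2 => ?_⟩
  · have a1 := hA _ _ h1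
    have a2 := hA _ _ h2
    exact (h.col x (by omega)).point_unique (by omega) (by omega) h1 h2
  · rcases lt_trichotomy x z with hlt | heq | hlt
    · exact (key hlt h1 h2).elim
    · exact heq
    · exact (key hlt h2 h1).elim

end IsGrowth

/-- Every sequence of shapes of the right form arises along the border of a growth diagram. -/
theorem exists_isGrowth (n : ℕ) (lam kap : ℕ → ℕ → ℕ) (u v : ℕ → ℕ) (h0 : ∀ m, lam 0 m = 0)
    (hn : ∀ m, lam n m = 0) (hl : ∀ x, Antitone (lam x)) (hk : ∀ x < n, Antitone (kap x))
    (hu : ∀ x < n, ∀ m, kap x m = lam x m + unitRow (u x) (m + 1))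
    (hv : ∀ x < n, ∀ m, kap x m = lam (x + 1) m + unitRow (v x) (m + 1)) :
    ∃ (B : ℕ → ℕ → Prop) (r c : ℕ → ℕ → ℕ), IsGrowth n B r c ∧ (∀ x y, B x y → x + y < n) ∧
      (∀ x ≤ n, ∀ m, cnt (c x) (n - x) (m + 1) = lam x m) ∧
      (∀ x < n, r x (n - x) = u x) ∧ ∀ x < n, c (x + 1) (n - x - 1) = v x := by
  have step : ∀ (x : ℕ) (w : ℕ → ℕ), ∃ (B : ℕ → Prop) (c c' r : ℕ → ℕ), x < n →
      IsYam (n - x - 1) w → (∀ m, cnt w (n - x - 1) (m + 1) = lam (x + 1) m) →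
      IsColumn (n - x) B c c' r ∧ (∀ y < n - x - 1, c' y = w y) ∧ c' (n - x - 1) = v x ∧
        r (n - x) = u x ∧ IsYam (n - x) c ∧ ∀ m, cnt c (n - x) (m + 1) = lam x m := by
    intro x w
    by_cases hx : x < n
    swap
    · exact ⟨fun _ => False, w, w, w, fun h => absurd h hx⟩
    by_cases hy : IsYam (n - x - 1) w
    swap
    · exact ⟨fun _ => False, w, w, w, fun _ h => absurd h hy⟩
    by_cases hs : ∀ m, cnt w (n - x - 1) (m + 1) = lam (x + 1) m
    swap
    · exact ⟨fun _ => False, w, w, w, fun _ _ h => absurd h hs⟩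
    obtain ⟨k, e⟩ : ∃ k, n - x = k + 1 := ⟨n - x - 1, by omega⟩
    simp only [e, Nat.add_sub_cancel] at hy hs ⊢
    -- Column `x` is one cell taller than its right neighbour; its extra right label is the border
    -- label `v x`.
    set c' : ℕ → ℕ := fun y => if y = k then v x else w y with hc'
    have e1 : ∀ y < k, c' y = w y := fun y hy => by simp [hc', show y ≠ k by omega]
    have e2 : c' k = v x := by simp [hc']
    have e3 : ∀ m, cnt c' (k + 1) (m + 1) = kap x m := fun m => by
      rw [cnt_succ, cnt_congr e1, hs, e2, hv x hx]
    have hyam : IsYam (k + 1) c' := by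
      intro Y hY m hm
      rcases Nat.lt_or_ge k Y with hlt | hge
      · obtain rfl : Y = k + 1 := by omega
        obtain ⟨m, rfl⟩ : ∃ m', m = m' + 1 := ⟨m - 1, by omega⟩
        rw [e3, e3]
        exact hk x hx (Nat.le_succ m)
      · exact (hy.congr fun y hy => (e1 y hy).symm) Y hge m hm
    obtain ⟨B, c, r, h1, h2, h3⟩ := exists_isColumn hyam (u := u x) (fun hne => by
      obtain ⟨m, hm⟩ : ∃ m, u x = m + 1 := ⟨u x - 1, by omega⟩
      rw [hm, e3, e3, hu x hx, hu x hx, hm]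
      have := hl x (Nat.le_succ m)
      simp [unitRow]
      exact this)
    refine ⟨B, c, c', r, fun _ _ _ => ⟨h1, e1, e2, h2, h3, fun m => ?_⟩⟩
    have := h1.cnt_eq (show 1 ≤ m + 1 by omega)
    rw [e3, hu x hx, h2] at this
    omega
  choose FB Fc Fc' Fr hF using step
  -- `W k` is the word to the left of the column of height `k`, obtained by repeated reverse
  -- insertion from the right end of the staircase.
  let W : ℕ → ℕ → ℕ := fun k => Nat.rec (fun _ => 0) (fun k w => Fc (n - k - 1) w) k
  have hW : ∀ x < n, W (n - x) = Fc x (W (n - x - 1)) := by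
    intro x hx
    obtain ⟨k, e⟩ : ∃ k, n - x = k + 1 := ⟨n - x - 1, by omega⟩
    simp only [e, Nat.add_sub_cancel]
    change Fc (n - k - 1) (W k) = _
    rw [show n - k - 1 = x by omega]
  have inv : ∀ k ≤ n, IsYam k (W k) ∧ ∀ m, cnt (W k) k (m + 1) = lam (n - k) m := by
    intro k
    induction k with
    | zero =>
      refine fun _ => ⟨fun Y hY m hm => ?_, fun m => ?_⟩
      · obtain rfl : Y = 0 := by omega
        simp [cnt_zero]
      · rw [cnt_zero, Nat.sub_zero, hn]
    | succ k ih =>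
      intro hk
      obtain ⟨i1, i2⟩ := ih (by omega)
      have := hF (n - (k + 1)) (W k) (by omega)
      rw [show n - (n - (k + 1)) - 1 = k by omega, show n - (n - (k + 1)) = k + 1 by omega,
        show n - (k + 1) + 1 = n - k by omega] at this
      exact (this i1 i2).2.2.2.2
  have hcol : ∀ x < n, _ := fun x hx => hF x (W (n - x - 1)) hx (inv (n - x - 1) (by omega)).1
    (by
      have := (inv (n - x - 1) (by omega)).2
      rwa [show n - (n - x - 1) = x + 1 by omega] at this)
  -- The empty shape `lam 0` leaves no nonzero letter in the leftmost word, as a growth diagram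
  -- requires.
  have hWn : ∀ y < n, W n y = 0 := by
    intro y hy
    by_contra hne
    have h1 : 0 < cnt (W n) n (W n y) := cnt_pos.2 ⟨y, hy, rfl⟩
    have h2 := (inv n le_rfl).2 (W n y - 1)
    rw [Nat.sub_self, h0, Nat.sub_add_cancel (by omega)] at h2
    omega
  -- The letter at height `n - x` belongs only to the column on the left, where it is the border
  -- label `v (x - 1)`.
  let c : ℕ → ℕ → ℕ := fun x y => if x = 0 then 0 else if y < n - x then W (n - x) y else v (x - 1)
  have hc : ∀ x y, y < n - x → c x y = W (n - x) y := by
    intro x y hy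
    by_cases hx : x = 0
    · subst hx
      simp [c, hWn y hy]
    · simp [c, hx, hy]
  have hcr : ∀ x < n, ∀ y < n - x, c (x + 1) y = Fc' x (W (n - x - 1)) y := by
    intro x hx y hy
    rcases Nat.lt_or_ge y (n - x - 1) with hlt | hge
    · rw [hc _ _ (by omega), (hcol x hx).2.1 y hlt, show n - (x + 1) = n - x - 1 by omega]
    · obtain rfl : y = n - x - 1 := by omega
      rw [(hcol x hx).2.2.1]
      simp [c, show ¬ n - x - 1 < n - (x + 1) by omega]
  refine ⟨fun x y => x + y < n ∧ FB x (W (n - x - 1)) y, fun x => Fr x (W (n - x - 1)), c,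
    ⟨fun y => by simp [c], fun x hx => ?_⟩, fun x y h => h.1, fun x hx m => ?_, fun x hx => ?_,
    fun x hx => ?_⟩
  · refine (hcol x hx).1.congr (fun y hy => ?_) (fun y hy => ?_) fun y hy => (hcr x hx y hy).symm
    · simp [show x + y < n by omega]
    · rw [hc x y hy, hW x hx]
  · rw [cnt_congr (hc x), (inv (n - x) (by omega)).2, show n - (n - x) = x by omega]
  · exact (hcol x hx).2.2.2.1
  · rw [hcr x hx _ (by omega), (hcol x hx).2.2.1]

/-! ### Conjugation of shapes. -/

/-- The conjugate of a shape. -/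
noncomputable def conj (f : ℕ → ℕ) (k : ℕ) : ℕ := sInf {m | f m ≤ k}

/-- A shape: an antitone function which is eventually zero. -/
structure IsShape (f : ℕ → ℕ) : Prop where
  anti : Antitone f
  zero : ∃ m, f m = 0

namespace IsShape

variable {f g : ℕ → ℕ}

theorem lt_conj (hf : IsShape f) {m k : ℕ} : m < conj f k ↔ k < f m := by
  have hne : {m | f m ≤ k}.Nonempty := by
    obtain ⟨m, hm⟩ := hf.zero
    exact ⟨m, by simp [hm]⟩
  constructor
  · intro h
    have := Nat.notMem_of_lt_sInf h
    simpa using this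
  · intro h
    by_contra hlt
    have h1 : f (conj f k) ≤ k := Nat.sInf_mem hne
    have := hf.anti (not_lt.1 hlt)
    omega

theorem conj_isShape (hf : IsShape f) : IsShape (conj f) := by
  refine ⟨fun a b hab => ?_, f 0, ?_⟩
  · by_contra h
    have h1 := hf.lt_conj.1 (not_le.1 h)
    have := hf.lt_conj.2 (show a < f (conj f a) by omega)
    omega
  · by_contra h
    have := hf.lt_conj.1 (Nat.pos_of_ne_zero h)
    omega

theorem conj_injective (hf : IsShape f) (hg : IsShape g) (h : conj f = conj g) : f = g := by
  funext m
  have key : ∀ k, k < f m ↔ k < g m := fun k => by rw [← hf.lt_conj, h, hg.lt_conj]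
  have h1 := key (f m)
  have h2 := key (g m)
  omega

/-- A box added to row `a` (counted from `0`) lies in column `f a`, so the conjugate gains a box in
row `f a`, with label `f a + 1`. That `v` and `u` vanish together is what preserves empty rows and
columns. -/
theorem conj_step (hf : IsShape f) (hg : IsShape g) {u : ℕ}
    (h : ∀ m, g m = f m + unitRow u (m + 1)) :
    ∃ v, (v ≠ 0 ↔ u ≠ 0) ∧ ∀ m, conj g m = conj f m + unitRow v (m + 1) := by
  rcases Nat.eq_zero_or_pos u with rfl | hu
  · refine ⟨0, Iff.rfl, fun m => ?_⟩
    have : g = f := by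
      funext m
      rw [h m]
      simp [unitRow]
    rw [this]
    simp [unitRow]
  · obtain ⟨a, rfl⟩ : ∃ a, u = a + 1 := ⟨u - 1, by omega⟩
    refine ⟨f a + 1, by omega, fun k => ?_⟩
    have key : ∀ m, m < conj g k ↔ k < f m + unitRow (a + 1) (m + 1) := fun m => by
      rw [hg.lt_conj, h]
    have key' : ∀ m, m < conj f k ↔ k < f m := fun m => hf.lt_conj
    have hga := h a
    simp only [unitRow, add_left_inj] at key hga h ⊢
    by_cases hk : f a = k
    · subst hk
      have e1 : conj f (f a) = a := by
        apply le_antisymm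
        · by_contra hlt
          have := (key' a).1 (by omega)
          omega
        · by_contra hlt
          have a1 := (key' (conj f (f a))).not.1 (lt_irrefl _)
          have a2 := hg.anti (show conj f (f a) ≤ a by omega)
          have a3 := h (conj f (f a))
          simp only [show a ≠ conj f (f a) by omega, if_true, if_false] at a3 hga
          omega
      have e2 : conj g (f a) = a + 1 := by
        apply le_antisymm
        · by_contra hlt
          have a1 := (key (a + 1)).1 (by omega)
          have a2 := hf.anti (Nat.le_succ a)
          simp at a1
          simp at a2
          omega
        · have := (key a).2 (by simp)
          omega
      rw [e1, e2]
      simp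
    · have e : ∀ m, m < conj g k ↔ m < conj f k := fun m => by
        rw [key, key']
        split_ifs with hm
        · subst hm
          omega
        · omega
      have h1 := e (conj f k)
      have h2 := e (conj g k)
      simp only [hk, if_false]
      omega

end IsShape

/-! ### Transposing an arrangement through its border shapes. -/

/-- The border shape of the growth diagram of `A` at `(x, y)`. -/
noncomputable def shape (A : ℕ → ℕ → Prop) (x y m : ℕ) : ℕ := cnt (rowLab A x) y (m + 1)

/-- The border shapes of `B` are the conjugates of those of `A`. -/
def IsTranspose (n : ℕ) (A B : ℕ → ℕ → Prop) : Prop :=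
  (∀ x < n, shape B x (n - x) = conj (shape A x (n - x))) ∧
    ∀ x < n, shape B (x + 1) (n - x) = conj (shape A (x + 1) (n - x))

theorem isShape_cnt {N : ℕ} {c : ℕ → ℕ} (h : IsYam N c) : IsShape fun m => cnt c N (m + 1) := by
  refine ⟨fun a b hab => h.cnt_anti (by omega) (by omega), (Finset.range N).sup c, ?_⟩
  by_contra hne
  obtain ⟨y, hy, he⟩ := cnt_pos.1 (Nat.pos_of_ne_zero hne)
  have := Finset.le_sup (f := c) (Finset.mem_range.2 hy)
  omega

namespace IsRook

variable {n : ℕ} {A B : ℕ → ℕ → Prop}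

theorem isShape (h : IsRook n A) {x : ℕ} (hx : x ≤ n) : IsShape (shape A x (n - x)) :=
  isShape_cnt (h.isGrowth.isYam hx)

theorem isShape_succ (h : IsRook n A) {x : ℕ} (hx : x < n) : IsShape (shape A (x + 1) (n - x)) :=
  isShape_cnt (h.isGrowth.isYam_succ hx)

theorem hasDec_iff (h : IsRook n A) {k x : ℕ} (hx : x < n) :
    HasDec A (k + 1) (x + 1) (n - x) ↔ 0 < shape A (x + 1) (n - x) k :=
  h.isGrowth.hasDec_iff (fun _ _ => h.board) (by omega) hx

theorem hasInc_iff (h : IsRook n A) {k x : ℕ} (hx : x < n) :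
    HasInc A (k + 1) (x + 1) (n - x) ↔ k < shape A (x + 1) (n - x) 0 :=
  h.isGrowth.hasInc_iff (fun _ _ => h.board) hx

/-- Conjugation is injective on shapes and the border determines the points; this makes the final
map injective. -/
theorem eq_of_isTranspose {A' : ℕ → ℕ → Prop} (h : IsRook n A) (h' : IsRook n A')
    (ht : IsTranspose n A B) (ht' : IsTranspose n A' B) (x y : ℕ) : A x y ↔ A' x y := by
  have key : x + y < n → (A x y ↔ A' x y) := h.isGrowth.determined h'.isGrowth
    (fun x hx m => congrFun ((h.isShape hx.le).conj_injective (h'.isShape hx.le)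
      ((ht.1 x hx).symm.trans (ht'.1 x hx))) m)
    (fun x hx m => congrFun ((h.isShape_succ hx).conj_injective (h'.isShape_succ hx)
      ((ht.2 x hx).symm.trans (ht'.2 x hx))) m)
  exact ⟨fun hA => (key (h.board hA)).1 hA, fun hA => (key (h'.board hA)).2 hA⟩

theorem hasDec_transpose (h : IsRook n A) (h' : IsRook n B) (ht : IsTranspose n A B) {k x : ℕ}
    (hx : x < n) : HasDec B (k + 1) (x + 1) (n - x) ↔ HasInc A (k + 1) (x + 1) (n - x) := by
  rw [h'.hasDec_iff hx, h.hasInc_iff hx, ht.2 x hx, (h.isShape_succ hx).lt_conj]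

theorem hasInc_transpose (h : IsRook n A) (h' : IsRook n B) (ht : IsTranspose n A B) {k x : ℕ}
    (hx : x < n) : HasInc B (k + 1) (x + 1) (n - x) ↔ HasDec A (k + 1) (x + 1) (n - x) := by
  rw [h'.hasInc_iff hx, h.hasDec_iff hx, ht.2 x hx, (h.isShape_succ hx).lt_conj]

/-- Conjugating all border shapes yields an arrangement with the same nonempty rows and columns. -/
theorem exists_transpose (h : IsRook n A) : ∃ B, IsRook n B ∧ IsTranspose n A B ∧
    (∀ x, (∃ y, B x y) ↔ ∃ y, A x y) ∧ ∀ y, (∃ x, B x y) ↔ ∃ x, A x y := by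
  set r : ℕ → ℕ → ℕ := fun x => colLab (A x) (rowLab A x)
  have hg : IsGrowth n A r (rowLab A) := h.isGrowth
  have hu : ∀ x, ∃ v, x < n → (v ≠ 0 ↔ r x (n - x) ≠ 0) ∧ ∀ m,
      conj (shape A (x + 1) (n - x)) m = conj (shape A x (n - x)) m + unitRow v (m + 1) := by
    intro x
    by_cases hx : x < n
    · obtain ⟨v, hv⟩ := (h.isShape hx.le).conj_step (h.isShape_succ hx) (u := r x (n - x))
        fun m => hg.cnt_succ_eq (by omega) hx (by omega)
      exact ⟨v, fun _ => hv⟩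
    · exact ⟨0, fun hh => absurd hh hx⟩
  have hv : ∀ x, ∃ v, x < n → (v ≠ 0 ↔ rowLab A (x + 1) (n - x - 1) ≠ 0) ∧ ∀ m,
      conj (shape A (x + 1) (n - x)) m =
        conj (shape A (x + 1) (n - (x + 1))) m + unitRow v (m + 1) := by
    intro x
    by_cases hx : x < n
    · obtain ⟨v, hv⟩ := (h.isShape (x := x + 1) hx).conj_step (h.isShape_succ hx)
        (u := rowLab A (x + 1) (n - x - 1)) fun m => by
          unfold shape
          rw [show n - (x + 1) = n - x - 1 by omega, ← cnt_succ, Nat.sub_add_cancel (by omega)]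
      exact ⟨v, fun _ => hv⟩
    · exact ⟨0, fun hh => absurd hh hx⟩
  choose u hu using hu
  choose v hv using hv
  have hz : ∀ f : ℕ → ℕ, f = (fun _ => 0) → ∀ m, conj f m = 0 := fun f hf m => by
    subst hf
    simp [conj]
  obtain ⟨B, s, d, h1, h2, h3, h4, h5⟩ := exists_isGrowth n
    -- `exists_isGrowth` asks for antitone shapes at every index, so the family is continued by zero
    -- beyond `n`.
    (fun x => if x ≤ n then conj (shape A x (n - x)) else fun _ => 0)
    (fun x => conj (shape A (x + 1) (n - x))) u v
    (by
      simp only [Nat.zero_le, if_true]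
      refine hz _ (funext fun m => ?_)
      by_contra hne
      obtain ⟨y, -, hy⟩ := cnt_pos.1 (Nat.pos_of_ne_zero hne)
      simp [rowLab] at hy)
    (by
      simp only [le_refl, if_true]
      refine hz _ (funext fun m => ?_)
      rw [shape, Nat.sub_self, cnt_zero])
    (fun x => by
      by_cases hx : x ≤ n
      · simpa only [hx, if_true] using (h.isShape hx).conj_isShape.anti
      · simpa only [hx, if_false] using antitone_const)
    (fun x hx => (h.isShape_succ hx).conj_isShape.anti)
    (fun x hx m => by simpa only [hx.le, if_true] using (hu x hx).2 m)
    (fun x hx m => by simpa only [show x + 1 ≤ n from hx, if_true] using (hv x hx).2 m)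
  have hB := h1.isRook h2
  have e : ∀ x y, x + y ≤ n → rowLab B x y = d x y := fun x y => hB.isGrowth.unique h1
  have t1 : ∀ x < n, ∀ m, shape B x (n - x) m = conj (shape A x (n - x)) m := fun x hx m => by
    have := h3 x hx.le m
    simp only [hx.le, if_true] at this
    rw [← this]
    exact cnt_congr (fun y hy => e x y (by omega)) _
  refine ⟨B, hB, ⟨fun x hx => funext (t1 x hx), fun x hx => funext fun m => ?_⟩, fun x => ?_,
    fun y => ?_⟩
  · rw [(hu x hx).2, ← t1 x hx, ← h4 x hx]
    have := h1.cnt_succ_eq (x := x) (Y := n - x) (m := m + 1) (by omega) hx (by omega)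
    rw [shape, shape, cnt_congr (fun y hy => e (x + 1) y (by omega)),
      cnt_congr (fun y hy => e x y (by omega)), this]
  · by_cases hx : x < n
    · rw [h1.exists_col_iff h2 hx, hg.exists_col_iff (fun _ _ => h.board) hx, h4 x hx, (hu x hx).1]
    · exact ⟨fun ⟨y, hy⟩ => absurd (h2 x y hy) (by omega),
        fun ⟨y, hy⟩ => absurd (h.board hy) (by omega)⟩
  · by_cases hy : y < n
    · rw [h1.exists_row_iff h2 hy, hg.exists_row_iff (fun _ _ => h.board) hy]
      have h6 := h5 (n - y - 1) (by omega)
      have h7 := (hv (n - y - 1) (by omega)).1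
      rw [show n - y - 1 + 1 = n - y by omega, show n - (n - y - 1) - 1 = y by omega] at h6 h7
      rw [h6, h7]
    · exact ⟨fun ⟨x, hx⟩ => absurd (h2 x y hx) (by omega),
        fun ⟨x, hx⟩ => absurd (h.board hx) (by omega)⟩

end IsRook

/-! ### Partitions and their enhanced representations -/

variable {n : ℕ}

theorem mem_interval_of_mem {P : SetPartition n} {B : Finset ℕ} (hB : B ∈ P.parts) {a : ℕ}
    (ha : a ∈ B) : 1 ≤ a ∧ a ≤ n := Finset.mem_Icc.1 (P.le hB ha)

theorem mem_standardRep {P : SetPartition n} {a b : ℕ} : (a, b) ∈ standardRep P ↔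
    ∃ B ∈ P.parts, a ∈ B ∧ b ∈ B ∧ a < b ∧ ∀ m ∈ B, ¬ (a < m ∧ m < b) := by
  unfold standardRep
  simp only [Finset.mem_filter, Finset.mem_product]
  exact ⟨fun h => h.2, fun ⟨B, hB, ha, hb, h⟩ => ⟨⟨P.le hB ha, P.le hB hb⟩, B, hB, ha, hb, h⟩⟩

theorem mem_loops {P : SetPartition n} {a b : ℕ} : (a, b) ∈ loops P ↔ a = b ∧ {a} ∈ P.parts := by
  unfold loops
  simp only [Finset.mem_image, Finset.mem_filter, Prod.mk.injEq]
  constructor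
  · rintro ⟨i, ⟨-, hi⟩, rfl, rfl⟩
    exact ⟨rfl, hi⟩
  · rintro ⟨rfl, h⟩
    exact ⟨a, ⟨P.le h (Finset.mem_singleton_self a), h⟩, rfl, rfl⟩

theorem mem_enhancedRep {P : SetPartition n} {a b : ℕ} : (a, b) ∈ enhancedRep P ↔
    (∃ B ∈ P.parts, a ∈ B ∧ b ∈ B ∧ a < b ∧ ∀ m ∈ B, ¬ (a < m ∧ m < b)) ∨
      a = b ∧ {a} ∈ P.parts := by
  rw [enhancedRep, Finset.mem_union, mem_standardRep, mem_loops]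

theorem exists_greatest_below {B : Finset ℕ} {m a : ℕ} (hm : m ∈ B) (hma : m < a) :
    ∃ i ∈ B, m ≤ i ∧ i < a ∧ ∀ k ∈ B, ¬ (i < k ∧ k < a) := by
  obtain ⟨i, hi, hmax⟩ := (B.filter (· < a)).exists_max_image id
    ⟨m, Finset.mem_filter.2 ⟨hm, hma⟩⟩
  obtain ⟨hiB, hia⟩ := Finset.mem_filter.1 hi
  refine ⟨i, hiB, hmax m (Finset.mem_filter.2 ⟨hm, hma⟩), hia, fun k hk hh => ?_⟩
  exact absurd (hmax k (Finset.mem_filter.2 ⟨hk, hh.2⟩)) (not_le.2 hh.1)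

theorem exists_least_above {B : Finset ℕ} {m a : ℕ} (hm : m ∈ B) (ham : a < m) :
    ∃ i ∈ B, a < i ∧ ∀ k ∈ B, ¬ (a < k ∧ k < i) := by
  obtain ⟨i, hi, hmin⟩ := (B.filter (a < ·)).exists_min_image id
    ⟨m, Finset.mem_filter.2 ⟨hm, ham⟩⟩
  obtain ⟨hiB, hia⟩ := Finset.mem_filter.1 hi
  refine ⟨i, hiB, hia, fun k hk hh => ?_⟩
  exact absurd (hmin k (Finset.mem_filter.2 ⟨hk, hh.1⟩)) (not_le.2 hh.2)

/-- The edge sets of partitions of `[n]` with given sets `S` and `T` of openers and closers. -/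
structure IsArcSet (n : ℕ) (S T : Finset ℕ) (E : ℕ → ℕ → Prop) : Prop where
  bounds : ∀ {a b}, E a b → 1 ≤ a ∧ a ≤ b ∧ b ≤ n
  right_unique : ∀ {a b b'}, E a b → E a b' → b = b'
  left_unique : ∀ {a a' b}, E a b → E a' b → a = a'
  right : ∀ a, 1 ≤ a → a ≤ n → ((∃ b, E a b) ↔ a ∉ T)
  left : ∀ b, 1 ≤ b → b ≤ n → ((∃ a, E a b) ↔ b ∉ S)

theorem mem_minElts {P : SetPartition n} {B : Finset ℕ} (hB : B ∈ P.parts) {a : ℕ} (ha : a ∈ B) :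
    a ∈ minElts P ↔ ∀ m ∈ B, a ≤ m := by
  unfold minElts
  simp only [Finset.mem_filter]
  constructor
  · rintro ⟨-, C, hC, h1, h2⟩ m hm
    obtain rfl := P.eq_of_mem_parts hB hC ha h1
    exact h2 hm
  · exact fun h => ⟨P.le hB ha, B, hB, ha, fun m hm => h m hm⟩

theorem mem_maxElts {P : SetPartition n} {B : Finset ℕ} (hB : B ∈ P.parts) {a : ℕ} (ha : a ∈ B) :
    a ∈ maxElts P ↔ ∀ m ∈ B, m ≤ a := by
  unfold maxElts
  simp only [Finset.mem_filter]
  constructor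
  · rintro ⟨-, C, hC, h1, h2⟩ m hm
    obtain rfl := P.eq_of_mem_parts hB hC ha h1
    exact h2 hm
  · exact fun h => ⟨P.le hB ha, B, hB, ha, fun m hm => h m hm⟩

theorem isArcSet_enhancedRep (P : SetPartition n) :
    IsArcSet n (minElts P \ maxElts P) (maxElts P \ minElts P)
      (fun a b => (a, b) ∈ enhancedRep P) where
  bounds := by
    intro a b h
    rcases mem_enhancedRep.1 h with ⟨B, hB, ha, hb, hab, -⟩ | ⟨rfl, hs⟩
    · have := mem_interval_of_mem hB ha
      have := mem_interval_of_mem hB hb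
      omega
    · have := mem_interval_of_mem hs (Finset.mem_singleton_self a)
      omega
  right_unique := by
    intro a b b' h h'
    rcases mem_enhancedRep.1 h with ⟨B, hB, ha, hb, hab, h⟩ | ⟨rfl, hs⟩ <;>
      rcases mem_enhancedRep.1 h' with ⟨C, hC, ha', hb', hab', h'⟩ | ⟨rfl, hs'⟩
    · obtain rfl := P.eq_of_mem_parts hB hC ha ha'
      have := h b' hb'
      have := h' b hb
      omega
    · obtain rfl := P.eq_of_mem_parts hB hs' ha (Finset.mem_singleton_self a)
      exact Finset.mem_singleton.1 hb
    · obtain rfl := P.eq_of_mem_parts hC hs ha' (Finset.mem_singleton_self a)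
      exact (Finset.mem_singleton.1 hb').symm
    · rfl
  left_unique := by
    intro a a' b h h'
    rcases mem_enhancedRep.1 h with ⟨B, hB, ha, hb, hab, h⟩ | ⟨rfl, hs⟩ <;>
      rcases mem_enhancedRep.1 h' with ⟨C, hC, ha', hb', hab', h'⟩ | ⟨rfl, hs'⟩
    · obtain rfl := P.eq_of_mem_parts hB hC hb hb'
      have := h a' ha'
      have := h' a ha
      omega
    · obtain rfl := P.eq_of_mem_parts hB hs' hb (Finset.mem_singleton_self _)
      exact Finset.mem_singleton.1 ha
    · obtain rfl := P.eq_of_mem_parts hC hs hb' (Finset.mem_singleton_self _)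
      exact (Finset.mem_singleton.1 ha').symm
    · rfl
  right := by
    intro a h1 hn
    obtain ⟨B, hB, ha⟩ := P.exists_mem (Finset.mem_Icc.2 ⟨h1, hn⟩)
    rw [Finset.mem_sdiff, mem_minElts hB ha, mem_maxElts hB ha]
    constructor
    · rintro ⟨b, hb⟩ ⟨h2, h3⟩
      rcases mem_enhancedRep.1 hb with ⟨C, hC, ha', hb, hab, h⟩ | ⟨rfl, hs⟩
      · obtain rfl := P.eq_of_mem_parts hB hC ha ha'
        have := h2 b hb
        omega
      · obtain rfl := P.eq_of_mem_parts hB hs ha (Finset.mem_singleton_self a)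
        exact h3 fun m hm => (Finset.mem_singleton.1 hm).ge
    · intro h
      by_cases hmax : ∀ m ∈ B, m ≤ a
      · have hmin : ∀ m ∈ B, a ≤ m := by
          by_contra hmin
          exact h ⟨hmax, hmin⟩
        have : B = {a} := Finset.eq_singleton_iff_unique_mem.2
          ⟨ha, fun m hm => le_antisymm (hmax m hm) (hmin m hm)⟩
        exact ⟨a, mem_enhancedRep.2 (Or.inr ⟨rfl, this ▸ hB⟩)⟩
      · push Not at hmax
        obtain ⟨m, hm, ham⟩ := hmax
        obtain ⟨b, hb, hab, hgap⟩ := exists_least_above hm ham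
        exact ⟨b, mem_enhancedRep.2 (Or.inl ⟨B, hB, ha, hb, hab, hgap⟩)⟩
  left := by
    intro a h1 hn
    obtain ⟨B, hB, ha⟩ := P.exists_mem (Finset.mem_Icc.2 ⟨h1, hn⟩)
    rw [Finset.mem_sdiff, mem_minElts hB ha, mem_maxElts hB ha]
    constructor
    · rintro ⟨b, hb⟩ ⟨h2, h3⟩
      rcases mem_enhancedRep.1 hb with ⟨C, hC, hb, ha', hab, h⟩ | ⟨rfl, hs⟩
      · obtain rfl := P.eq_of_mem_parts hB hC ha ha'
        have := h2 b hb
        omega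
      · obtain rfl := P.eq_of_mem_parts hB hs ha (Finset.mem_singleton_self _)
        exact h3 fun m hm => (Finset.mem_singleton.1 hm).le
    · intro h
      by_cases hmin : ∀ m ∈ B, a ≤ m
      · have hmax : ∀ m ∈ B, m ≤ a := by
          by_contra hmax
          exact h ⟨hmin, hmax⟩
        have : B = {a} := Finset.eq_singleton_iff_unique_mem.2
          ⟨ha, fun m hm => le_antisymm (hmax m hm) (hmin m hm)⟩
        exact ⟨a, mem_enhancedRep.2 (Or.inr ⟨rfl, this ▸ hB⟩)⟩
      · push Not at hmin
        obtain ⟨m, hm, ham⟩ := hmin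
        obtain ⟨b, hb, -, hab, hgap⟩ := exists_greatest_below hm ham
        exact ⟨b, mem_enhancedRep.2 (Or.inl ⟨B, hB, hb, ha, hab, hgap⟩)⟩

/-- Each element of a block is joined to its predecessor by an arc, so the arcs alone connect the
block. -/
theorem exists_part_of_enhancedRep_eq {P Q : SetPartition n} (h : enhancedRep P = enhancedRep Q)
    {B : Finset ℕ} (hB : B ∈ P.parts) {a b : ℕ} (ha : a ∈ B) (hb : b ∈ B) (hab : a ≤ b) :
    ∃ C ∈ Q.parts, a ∈ C ∧ b ∈ C := by
  induction b using Nat.strong_induction_on with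
  | _ b ih =>
    rcases hab.eq_or_lt with rfl | hlt
    · obtain ⟨C, hC, haC⟩ := Q.exists_mem (P.le hB ha)
      exact ⟨C, hC, haC, haC⟩
    obtain ⟨i, hi, hai, hib, hgap⟩ := exists_greatest_below ha hlt
    have hrep : (i, b) ∈ enhancedRep P := mem_enhancedRep.2 (Or.inl ⟨B, hB, hi, hb, hib, hgap⟩)
    rw [h] at hrep
    obtain ⟨C, hC, haC, hiC⟩ := ih i hib hi hai
    rcases mem_enhancedRep.1 hrep with ⟨C', hC', hiC', hb', -, -⟩ | ⟨he, -⟩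
    · obtain rfl := Q.eq_of_mem_parts hC hC' hiC hiC'
      exact ⟨C, hC, haC, hb'⟩
    · omega

theorem parts_subset_of_enhancedRep_eq {P Q : SetPartition n} (h : enhancedRep P = enhancedRep Q) :
    P.parts ⊆ Q.parts := by
  have key : ∀ {P Q : SetPartition n}, enhancedRep P = enhancedRep Q → ∀ {B : Finset ℕ},
      B ∈ P.parts → ∀ {a b}, a ∈ B → b ∈ B → ∃ C ∈ Q.parts, a ∈ C ∧ b ∈ C := by
    intro P Q h B hB a b ha hb
    rcases le_total a b with hab | hab
    · exact exists_part_of_enhancedRep_eq h hB ha hb hab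
    · obtain ⟨C, hC, h1, h2⟩ := exists_part_of_enhancedRep_eq h hB hb ha hab
      exact ⟨C, hC, h2, h1⟩
  intro B hB
  obtain ⟨a, ha⟩ := P.nonempty_of_mem_parts hB
  obtain ⟨C, hC, haC⟩ := Q.exists_mem (P.le hB ha)
  have : B = C := by
    ext b
    constructor
    · intro hb
      obtain ⟨C', hC', h1, h2⟩ := key h hB ha hb
      obtain rfl := Q.eq_of_mem_parts hC hC' haC h1
      exact h2
    · intro hb
      obtain ⟨B', hB', h1, h2⟩ := key h.symm hC haC hb
      obtain rfl := P.eq_of_mem_parts hB hB' ha h1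
      exact h2
  exact this ▸ hC

theorem enhancedRep_injective : Function.Injective (enhancedRep (n := n)) := fun _ _ h =>
  Finpartition.ext ((parts_subset_of_enhancedRep_eq h).antisymm
    (parts_subset_of_enhancedRep_eq h.symm))

/-! ### Recovering a partition from its arcs. -/

open Classical in
/-- The start of the maximal path of non-loop edges of `E` that ends in `b`. -/
noncomputable def root (E : ℕ → ℕ → Prop) (b : ℕ) : ℕ :=
  if h : ∃ a, a < b ∧ E a b then root E h.choose else b
termination_by b
decreasing_by exact h.choose_spec.1

namespace IsArcSet

variable {S T : Finset ℕ} {E : ℕ → ℕ → Prop}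

theorem root_eq (h : IsArcSet n S T E) {a b : ℕ} (hE : E a b) : root E b = root E a := by
  rcases (h.bounds hE).2.1.eq_or_lt with rfl | hlt
  · rfl
  · have hex : ∃ a, a < b ∧ E a b := ⟨a, hlt, hE⟩
    rw [root, dif_pos hex, h.left_unique hE hex.choose_spec.2]

theorem root_of_not (hno : ¬ ∃ a, a < b ∧ E a b) : root E b = b := by
  rw [root, dif_neg hno]

theorem root_le (h : IsArcSet n S T E) (b : ℕ) : root E b ≤ b := by
  induction b using Nat.strong_induction_on with
  | _ b ih =>
    by_cases hex : ∃ a, a < b ∧ E a b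
    · obtain ⟨a, hlt, hE⟩ := hex
      rw [h.root_eq hE]
      exact (ih a hlt).trans hlt.le
    · rw [root_of_not hex]

theorem exists_pred (h : IsArcSet n S T E) {a b : ℕ} (hab : a < b) (hr : root E a = root E b) :
    ∃ i, i < b ∧ E i b := by
  by_contra hno
  rw [root_of_not hno] at hr
  have := h.root_le a
  omega

/-- Descending from `b` along arcs must hit `a`: an arc jumping over `a` would start at a point that
also has an arc ending at or before `a`, against right uniqueness. -/
theorem exists_succ (h : IsArcSet n S T E) {a b : ℕ} (hab : a < b) (hr : root E a = root E b) :
    ∃ s, E a s ∧ a < s ∧ s ≤ b := by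
  induction b using Nat.strong_induction_on generalizing a with
  | _ b ih =>
    obtain ⟨i, hi, hE⟩ := h.exists_pred hab hr
    have hri := h.root_eq hE
    rcases lt_trichotomy a i with hlt | rfl | hlt
    · obtain ⟨s, h1, h2, h3⟩ := ih i hi hlt (hr.trans hri)
      exact ⟨s, h1, h2, by omega⟩
    · exact ⟨b, hE, hab, le_rfl⟩
    · obtain ⟨s, h1, h2, h3⟩ := ih a hab hlt (hri.symm.trans hr.symm)
      have := h.right_unique hE h1
      omega

open Classical in
theorem exists_partition (h : IsArcSet n S T E) (hST : Disjoint S T) :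
    ∃ P : SetPartition n, ∀ a b, (a, b) ∈ enhancedRep P ↔ E a b := by
  let F : ℕ → Finset ℕ := fun a => (interval n).filter fun x => root E x = root E a
  have hF : ∀ {a x}, x ∈ F a ↔ (1 ≤ x ∧ x ≤ n) ∧ root E x = root E a := fun {a x} => by
    simp [F]
  let P : SetPartition n := Finpartition.ofExistsUnique ((interval n).image F)
    (fun p hp => by
      obtain ⟨a, -, rfl⟩ := Finset.mem_image.1 hp
      exact Finset.filter_subset _ _)
    (fun a ha => by
      refine ⟨F a, ⟨Finset.mem_image_of_mem F ha, hF.2 ⟨Finset.mem_Icc.1 ha, rfl⟩⟩, ?_⟩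
      rintro B ⟨hB, haB⟩
      obtain ⟨b, -, rfl⟩ := Finset.mem_image.1 hB
      have := (hF.1 haB).2
      ext x
      rw [hF, hF, this])
    (fun hp => by
      obtain ⟨a, ha, he⟩ := Finset.mem_image.1 hp
      have : a ∈ F a := hF.2 ⟨Finset.mem_Icc.1 ha, rfl⟩
      rw [he] at this
      simp at this)
  have hP : ∀ {B}, B ∈ P.parts ↔ ∃ a, (1 ≤ a ∧ a ≤ n) ∧ F a = B := fun {B} => by
    simp [P, Finpartition.ofExistsUnique]
  refine ⟨P, fun a b => ?_⟩
  rw [mem_enhancedRep]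
  constructor
  · rintro (⟨B, hB, ha, hb, hab, hm⟩ | ⟨rfl, hB⟩)
    · obtain ⟨x, -, rfl⟩ := hP.1 hB
      rw [hF] at ha hb
      obtain ⟨s, h1, h2, h3⟩ := h.exists_succ hab (ha.2.trans hb.2.symm)
      have := hm s (hF.2 ⟨by omega, (h.root_eq h1).trans ha.2⟩)
      obtain rfl : s = b := by omega
      exact h1
    · obtain ⟨x, -, hx⟩ := hP.1 hB
      have ha : a ∈ F x := by simp [hx]
      rw [hF] at ha
      have huniq : ∀ y, 1 ≤ y → y ≤ n → root E y = root E a → y = a := fun y h1 h2 h3 => by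
        have : y ∈ F x := hF.2 ⟨⟨h1, h2⟩, h3.trans ha.2⟩
        rw [hx] at this
        simpa using this
      -- As `S` and `T` are disjoint, some edge starts or ends at `a`. Its other end lies in the
      -- same block `{a}`, so it is a loop.
      by_cases haT : a ∈ T
      · obtain ⟨i, hi⟩ := (h.left a ha.1.1 ha.1.2).2 fun haS =>
          Finset.disjoint_left.1 hST haS haT
        have := h.bounds hi
        obtain rfl := huniq i (by omega) (by omega) (h.root_eq hi).symm
        exact hi
      · obtain ⟨i, hi⟩ := (h.right a ha.1.1 ha.1.2).2 haT
        have := h.bounds hi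
        obtain rfl := huniq i (by omega) (by omega) (h.root_eq hi)
        exact hi
  · intro hE
    have hb := h.bounds hE
    rcases hb.2.1.eq_or_lt with rfl | hlt
    · refine Or.inr ⟨rfl, hP.2 ⟨a, by omega, ?_⟩⟩
      refine Finset.eq_singleton_iff_unique_mem.2 ⟨hF.2 ⟨by omega, rfl⟩, fun x hx => ?_⟩
      have hx := (hF.1 hx).2
      rcases lt_trichotomy x a with hlt | heq | hlt
      · obtain ⟨i, h1, h2⟩ := h.exists_pred hlt hx
        have := h.left_unique hE h2
        omega
      · exact heq
      · obtain ⟨s, h1, h2, h3⟩ := h.exists_succ hlt hx.symm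
        have := h.right_unique hE h1
        omega
    · refine Or.inl ⟨F a, hP.2 ⟨a, by omega, rfl⟩, hF.2 ⟨by omega, rfl⟩,
        hF.2 ⟨by omega, h.root_eq hE⟩, hlt, fun m hm hh => ?_⟩
      obtain ⟨s, h1, h2, h3⟩ := h.exists_succ hh.1 (hF.1 hm).2.symm
      have := h.right_unique hE h1
      omega

/-- The edges determine the openers, and likewise the closers; this identifies the sets `S` and `T`
of the transposed partition. -/
theorem left_set_unique {S' T' : Finset ℕ} (h : IsArcSet n S T E) (h' : IsArcSet n S' T' E)
    (hS : S ⊆ interval n) (hS' : S' ⊆ interval n) : S = S' := by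
  ext b
  constructor <;> intro hb
  · have hi := Finset.mem_Icc.1 (hS hb)
    by_contra hb'
    exact (h.left b hi.1 hi.2).1 ((h'.left b hi.1 hi.2).2 hb') hb
  · have hi := Finset.mem_Icc.1 (hS' hb)
    by_contra hb'
    exact (h'.left b hi.1 hi.2).1 ((h.left b hi.1 hi.2).2 hb') hb

theorem right_set_unique {S' T' : Finset ℕ} (h : IsArcSet n S T E) (h' : IsArcSet n S' T' E)
    (hT : T ⊆ interval n) (hT' : T' ⊆ interval n) : T = T' := by
  ext b
  constructor <;> intro hb
  · have hi := Finset.mem_Icc.1 (hT hb)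
    by_contra hb'
    exact (h.right b hi.1 hi.2).1 ((h'.right b hi.1 hi.2).2 hb') hb
  · have hi := Finset.mem_Icc.1 (hT' hb)
    by_contra hb'
    exact (h'.right b hi.1 hi.2).1 ((h.right b hi.1 hi.2).2 hb') hb

end IsArcSet

/-! ### Crossings and nestings as chains in the staircase. -/

/-- The enhanced representation of `P` as an arrangement of points in the staircase. -/
def cells (P : SetPartition n) (x y : ℕ) : Prop := (x + 1, n - y) ∈ enhancedRep P

theorem cells_iff {P : SetPartition n} {a b : ℕ} :
    (a, b) ∈ enhancedRep P ↔ (1 ≤ a ∧ b ≤ n) ∧ cells P (a - 1) (n - b) := by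
  unfold cells
  constructor
  · intro h
    have := (isArcSet_enhancedRep P).bounds h
    rw [show a - 1 + 1 = a by omega, show n - (n - b) = b by omega]
    exact ⟨by omega, h⟩
  · rintro ⟨h1, h2⟩
    rwa [show a - 1 + 1 = a by omega, show n - (n - b) = b by omega] at h2

theorem isRook_cells (P : SetPartition n) : IsRook n (cells P) := by
  have h := isArcSet_enhancedRep P
  constructor
  · intro x y hxy
    have := h.bounds hxy
    omega
  · intro x y z h1 h2
    have a1 := h.bounds h1
    have a2 := h.bounds h2
    have := h.right_unique h1 h2
    omega
  · intro x z y h1 h2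
    have := h.left_unique h1 h2
    omega

theorem cells_injective {P Q : SetPartition n} (h : ∀ x y, cells P x y ↔ cells Q x y) : P = Q :=
  enhancedRep_injective <| Finset.ext fun ⟨a, b⟩ => by rw [cells_iff, cells_iff, h]

theorem succ_le_enhancedCr {P : SetPartition n} {k : ℕ} :
    k + 1 ≤ enhancedCr P ↔ ∃ x < n, HasDec (cells P) (k + 1) (x + 1) (n - x) := by
  unfold enhancedCr
  rw [Finset.le_sup_iff (Nat.succ_pos k)]
  simp only [Finset.mem_filter, Finset.mem_powerset]
  constructor
  · rintro ⟨A, ⟨hA, i, j, hi, hj, hij, he⟩, hk⟩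
    generalize A.card = K at *
    have hmem : ∀ a, (i a, j a) ∈ enhancedRep P := fun a => hA (he ▸ Finset.mem_image_of_mem _ (Finset.mem_univ a))
    have hb := fun a => (isArcSet_enhancedRep P).bounds (hmem a)
    have hc := fun a => (cells_iff.1 (hmem a)).2
    have hlast := hb ⟨k, by omega⟩
    -- Only the first `k + 1` edges are kept. With `x + 1` the largest of their left ends, the
    -- rectangle says that every left end is at most `x + 1` and every right end at least `x + 1`.
    refine ⟨i ⟨k, by omega⟩ - 1, by omega, fun a => if h : a < K then i ⟨a, h⟩ - 1 else 0,
      fun a => if h : a < K then n - j ⟨a, h⟩ else 0, fun a ha => ?_, fun a b hab hbk => ?_⟩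
    · have ha' : a < K := by omega
      simp only [ha', dif_pos]
      have h1 := hi.monotone (show (⟨a, ha'⟩ : Fin K) ≤ ⟨k, by omega⟩ from Nat.lt_succ_iff.1 ha)
      have h2 := hij ⟨k, by omega⟩ ⟨a, ha'⟩
      exact ⟨hc _, by omega, by omega⟩
    · have ha' : a < K := by omega
      have hb' : b < K := by omega
      simp only [ha', hb', dif_pos]
      have h1 := hi (show (⟨a, ha'⟩ : Fin K) < ⟨b, hb'⟩ from hab)
      have h2 := hj (show (⟨a, ha'⟩ : Fin K) < ⟨b, hb'⟩ from hab)
      have h3 := hb ⟨a, ha'⟩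
      have h4 := hb ⟨b, hb'⟩
      omega
  · rintro ⟨x, hx, f, g, h1, h2⟩
    have hf : StrictMono fun a : Fin (k + 1) => f a + 1 := fun a b hab => by
      have := h2 a b hab b.2
      simp only
      omega
    have hcard : (Finset.univ.image fun a : Fin (k + 1) => (f a + 1, n - g a)).card = k + 1 := by
      rw [Finset.card_image_of_injective _ fun a b hab => hf.injective (Prod.mk.inj hab).1]
      simp
    refine ⟨_, ⟨?_, ?_⟩, hcard.ge⟩
    · intro e he
      obtain ⟨a, -, rfl⟩ := Finset.mem_image.1 he
      exact (h1 a a.2).1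
    · rw [hcard]
      refine ⟨_, _, hf, fun a b hab => ?_, fun a b => ?_, rfl⟩
      · have := h2 a b hab b.2
        have := h1 a a.2
        omega
      · have := h1 a a.2
        have := h1 b b.2
        omega

theorem succ_le_enhancedNe {P : SetPartition n} {k : ℕ} :
    k + 1 ≤ enhancedNe P ↔ ∃ x < n, HasInc (cells P) (k + 1) (x + 1) (n - x) := by
  unfold enhancedNe
  rw [Finset.le_sup_iff (Nat.succ_pos k)]
  simp only [Finset.mem_filter, Finset.mem_powerset]
  constructor
  · rintro ⟨A, ⟨hA, i, j, hi, hj, hij, he⟩, hk⟩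
    generalize A.card = K at *
    have hmem : ∀ a, (i a, j a) ∈ enhancedRep P := fun a => hA (he ▸ Finset.mem_image_of_mem _ (Finset.mem_univ a))
    have hb := fun a => (isArcSet_enhancedRep P).bounds (hmem a)
    have hc := fun a => (cells_iff.1 (hmem a)).2
    have hlast := hb ⟨k, by omega⟩
    -- The rectangle is chosen as for crossings; only the direction of the right ends, and so of the
    -- chain, is reversed.
    refine ⟨i ⟨k, by omega⟩ - 1, by omega, fun a => if h : a < K then i ⟨a, h⟩ - 1 else 0,
      fun a => if h : a < K then n - j ⟨a, h⟩ else 0, fun a ha => ?_, fun a b hab hbk => ?_⟩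
    · have ha' : a < K := by omega
      simp only [ha', dif_pos]
      have h1 := hi.monotone (show (⟨a, ha'⟩ : Fin K) ≤ ⟨k, by omega⟩ from Nat.lt_succ_iff.1 ha)
      have h2 := hij ⟨k, by omega⟩ ⟨a, ha'⟩
      exact ⟨hc _, by omega, by omega⟩
    · have ha' : a < K := by omega
      have hb' : b < K := by omega
      simp only [ha', hb', dif_pos]
      have h1 := hi (show (⟨a, ha'⟩ : Fin K) < ⟨b, hb'⟩ from hab)
      have h2 := hj (show (⟨a, ha'⟩ : Fin K) < ⟨b, hb'⟩ from hab)
      have h3 := hb ⟨a, ha'⟩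
      have h4 := hb ⟨b, hb'⟩
      omega
  · rintro ⟨x, hx, f, g, h1, h2⟩
    have hf : StrictMono fun a : Fin (k + 1) => f a + 1 := fun a b hab => by
      have := h2 a b hab b.2
      simp only
      omega
    have hcard : (Finset.univ.image fun a : Fin (k + 1) => (f a + 1, n - g a)).card = k + 1 := by
      rw [Finset.card_image_of_injective _ fun a b hab => hf.injective (Prod.mk.inj hab).1]
      simp
    refine ⟨_, ⟨?_, ?_⟩, hcard.ge⟩
    · intro e he
      obtain ⟨a, -, rfl⟩ := Finset.mem_image.1 he
      exact (h1 a a.2).1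
    · rw [hcard]
      refine ⟨_, _, hf, fun a b hab => ?_, fun a b => ?_, rfl⟩
      · have := h2 a b hab b.2
        have := h1 b b.2
        omega
      · have := h1 a a.2
        have := h1 b b.2
        omega

theorem eq_of_succ_le_iff {a b : ℕ} (h : ∀ k, k + 1 ≤ a ↔ k + 1 ≤ b) : a = b := by
  have h1 := h (a - 1)
  have h2 := h (b - 1)
  omega

/-- Transposition of the border shapes exchanges crossings and nestings. -/
theorem exists_transpose_partition {S T : Finset ℕ} (hST : Disjoint S T) {P : SetPartition n}
    (hP : P ∈ partitionsWith n S T) : ∃ Q ∈ partitionsWith n S T,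
      IsTranspose n (cells P) (cells Q) ∧ enhancedCr Q = enhancedNe P ∧
        enhancedNe Q = enhancedCr P := by
  unfold partitionsWith at hP ⊢
  obtain ⟨-, rfl, rfl⟩ := Finset.mem_filter.1 hP
  have hP := isRook_cells P
  have harc := isArcSet_enhancedRep P
  obtain ⟨B, hB, ht, hcol, hrow⟩ := hP.exists_transpose
  have hE : IsArcSet n (minElts P \ maxElts P) (maxElts P \ minElts P)
      (fun a b => (1 ≤ a ∧ b ≤ n) ∧ B (a - 1) (n - b)) := by
    refine ⟨?_, ?_, ?_, ?_, ?_⟩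
    · rintro a b ⟨h1, h2⟩
      have := hB.board h2
      omega
    · rintro a b b' ⟨h1, h2⟩ ⟨h3, h4⟩
      have := hB.col h2 h4
      omega
    · rintro a a' b ⟨h1, h2⟩ ⟨h3, h4⟩
      have := hB.row h2 h4
      omega
    · intro a h1 h2
      rw [← harc.right a h1 h2]
      constructor
      · rintro ⟨b, -, hb⟩
        obtain ⟨y, hy⟩ := (hcol _).1 ⟨_, hb⟩
        refine ⟨n - y, ?_⟩
        have : cells P (a - 1) y := hy
        unfold cells at this
        rwa [show a - 1 + 1 = a by omega] at this
      · rintro ⟨b, hb⟩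
        obtain ⟨y, hy⟩ := (hcol (a - 1)).2 ⟨_, (cells_iff.1 hb).2⟩
        have := hB.board hy
        exact ⟨n - y, by omega, by rwa [show n - (n - y) = y by omega]⟩
    · intro b h1 h2
      rw [← harc.left b h1 h2]
      constructor
      · rintro ⟨a, -, ha⟩
        obtain ⟨x, hx⟩ := (hrow _).1 ⟨_, ha⟩
        refine ⟨x + 1, ?_⟩
        have : cells P x (n - b) := hx
        unfold cells at this
        rwa [show n - (n - b) = b by omega] at this
      · rintro ⟨a, ha⟩
        obtain ⟨x, hx⟩ := (hrow (n - b)).2 ⟨_, (cells_iff.1 ha).2⟩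
        exact ⟨x + 1, by omega, by simpa using hx⟩
  obtain ⟨Q, hQ⟩ := hE.exists_partition hST
  have hcells : cells Q = B := by
    ext x y
    unfold cells
    rw [hQ]
    constructor
    · rintro ⟨-, h⟩
      have := hB.board h
      rwa [show x + 1 - 1 = x by omega, show n - (n - y) = y by omega] at h
    · intro h
      have := hB.board h
      rw [show x + 1 - 1 = x by omega, show n - (n - y) = y by omega]
      exact ⟨by omega, h⟩
  have hE' : IsArcSet n (minElts Q \ maxElts Q) (maxElts Q \ minElts Q)
      (fun a b => (1 ≤ a ∧ b ≤ n) ∧ B (a - 1) (n - b)) := by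
    have := isArcSet_enhancedRep Q
    simp only [hQ] at this
    exact this
  have hmin : ∀ R : SetPartition n, minElts R \ maxElts R ⊆ interval n := fun R =>
    Finset.sdiff_subset.trans fun _ h => by
      simp only [minElts, Finset.mem_filter] at h
      exact h.1
  have hmax : ∀ R : SetPartition n, maxElts R \ minElts R ⊆ interval n := fun R =>
    Finset.sdiff_subset.trans fun _ h => by
      simp only [maxElts, Finset.mem_filter] at h
      exact h.1
  refine ⟨Q, Finset.mem_filter.2 ⟨Finset.mem_univ _, hE'.left_set_unique hE (hmin Q) (hmin P),
    hE'.right_set_unique hE (hmax Q) (hmax P)⟩, hcells ▸ ht, ?_, ?_⟩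
  · refine eq_of_succ_le_iff fun k => ?_
    rw [succ_le_enhancedCr, succ_le_enhancedNe, hcells]
    exact exists_congr fun x => and_congr_right fun hx => hP.hasDec_transpose hB ht hx
  · refine eq_of_succ_le_iff fun k => ?_
    rw [succ_le_enhancedCr, succ_le_enhancedNe, hcells]
    exact exists_congr fun x => and_congr_right fun hx => hP.hasInc_transpose hB ht hx

/-! ### The injection and the symmetry. -/

theorem jointCount_le {S T : Finset ℕ} (hST : Disjoint S T) (i j : ℕ) :
    jointCount n S T i j ≤ jointCount n S T j i := by
  have key : ∀ P : SetPartition n, ∃ Q : SetPartition n, P ∈ partitionsWith n S T →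
      Q ∈ partitionsWith n S T ∧ IsTranspose n (cells P) (cells Q) ∧
        enhancedCr Q = enhancedNe P ∧ enhancedNe Q = enhancedCr P := by
    intro P
    by_cases hP : P ∈ partitionsWith n S T
    · obtain ⟨Q, hQ⟩ := exists_transpose_partition hST hP
      exact ⟨Q, fun _ => hQ⟩
    · exact ⟨P, fun h => absurd h hP⟩
  choose φ hφ using key
  unfold jointCount
  refine Finset.card_le_card_of_injOn φ (fun P hP => ?_) fun P hP Q hQ he => ?_
  · obtain ⟨h1, h2, h3⟩ := Finset.mem_filter.1 hP
    obtain ⟨a1, -, a2, a3⟩ := hφ P h1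
    exact Finset.mem_filter.2 ⟨a1, a2.trans h3, a3.trans h2⟩
  · have h1 := (hφ P (Finset.mem_filter.1 hP).1).2.1
    have h2 := (hφ Q (Finset.mem_filter.1 hQ).1).2.1
    rw [← he] at h2
    exact cells_injective ((isRook_cells P).eq_of_isTranspose (isRook_cells Q) h1 h2)

end EnhancedPartition

theorem theorem4p1 (n : ℕ) (S T : Finset ℕ) (hS : S ⊆ Finset.Icc 1 n) (hT : T ⊆ Finset.Icc 1 n)
    (hST : Disjoint S T) (hcard : S.card = T.card) (i j : ℕ) :
    EnhancedPartition.jointCount n S T i j = EnhancedPartition.jointCount n S T j i :=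
  le_antisymm (EnhancedPartition.jointCount_le hST i j) (EnhancedPartition.jointCount_le hST j i)
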